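/- There is a polynomial-time algorithm (in the real RAM model, with the operations $+,-,\times,/,\sqrt{\cdot}$ and comparisons of real numbers at unit cost, integer addressing, and no rounding) which, given any nonempty finite set $P$ of $n$ distinct points in the plane $\mathbb{R}^2$, computes a noncrossing spanning tree $T$ of $P$ such that \[ \operatorname{len}(T) \;\ge\; 0.519\cdot \operatorname{len}(T') \qquad\text{for every noncrossing spanning tree } T' \text{ of } P. \] That is, a $0.519$-approximation for the longest noncrossing spanning tree can be computed in polynomial time. Here a spanning tree of $P$ is a tree with vertex set $P$ whose edges are drawn as straight segments, $\operatorname{len}$ is the sum of the Euclidean lengths of the edges, and a tree is noncrossing if no two of its edges cross, where two segments cross if they do not lie on a common line and have a point in common that is interior to both. (If no three points of $P$ are collinear, noncrossing means that any two distinct edges meet at most in a common endpoint.) -/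

import Mathlib

/-! ## Noncrossing spanning trees of planar point sets -/

/-- The Euclidean plane. -/
abbrev Plane : Type := EuclideanSpace ℝ (Fin 2)

/-- The segments `ab` and `cd` cross: they do not lie on a common line and they have a point in
common that is interior to both of them. -/
def SegmentsCross (a b c d : Plane) : Prop :=
  ¬ Collinear ℝ {a, b, c, d} ∧ (openSegment ℝ a b ∩ openSegment ℝ c d).Nonempty

/-- The points `P 0, …, P (n - 1)` are the vertices, and every edge `u v` of the graph `T` is drawn
as the straight segment from `P u` to `P v`. No two edges cross. -/
def Noncrossing {n : ℕ} (P : Fin n → Plane) (T : SimpleGraph (Fin n)) : Prop :=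
  ∀ a b c d : Fin n, T.Adj a b → T.Adj c d → ¬ SegmentsCross (P a) (P b) (P c) (P d)

/-- `T` is a noncrossing spanning tree of the point set `P`. -/
def IsNoncrossingSpanningTree {n : ℕ} (P : Fin n → Plane) (T : SimpleGraph (Fin n)) : Prop :=
  T.IsTree ∧ Noncrossing P T

open Classical in
/-- The total Euclidean length of the edges of `T`. -/
noncomputable def totalLength {n : ℕ} (P : Fin n → Plane) (T : SimpleGraph (Fin n)) : ℝ :=
  ∑ e ∈ T.edgeFinset, Sym2.lift ⟨fun u v => dist (P u) (P v), fun _ _ => dist_comm _ _⟩ e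

/-- If no three of the points are collinear, then a graph is noncrossing exactly if any two
different edges meet in common endpoints only. -/
theorem noncrossing_iff_of_no_three_collinear {n : ℕ} (P : Fin n → Plane)
    (hP : ∀ i j k : Fin n, i ≠ j → i ≠ k → j ≠ k → ¬ Collinear ℝ {P i, P j, P k})
    (T : SimpleGraph (Fin n)) :
    Noncrossing P T ↔
      ∀ a b c d : Fin n, T.Adj a b → T.Adj c d → s(a, b) ≠ s(c, d) →
        segment ℝ (P a) (P b) ∩ segment ℝ (P c) (P d) ⊆ {P a, P b} ∩ {P c, P d} := by
  have key : ∀ a b c : Fin n, ∀ x : Plane, a ≠ b → a ≠ c → b ≠ c →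
      x ∈ segment ℝ (P a) (P b) → x ∈ segment ℝ (P a) (P c) → x = P a := by
    intro a b c x hab hac hbc h1 h2
    by_contra hx
    refine hP a b c hab hac hbc ?_
    have hb : P b ∈ line[ℝ, P a, x] := by
      have h3 : Wbtw ℝ (P a) x (P b) := mem_segment_iff_wbtw.1 h1
      exact h3.right_mem_affineSpan_of_left_ne (Ne.symm hx)
    have hc : P c ∈ line[ℝ, P a, x] := by
      have h3 : Wbtw ℝ (P a) x (P c) := mem_segment_iff_wbtw.1 h2
      exact h3.right_mem_affineSpan_of_left_ne (Ne.symm hx)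
    exact collinear_triple_of_mem_affineSpan_pair (left_mem_affineSpan_pair ℝ _ _) hb hc
  have key2 : ∀ a c d : Fin n, a ≠ c → a ≠ d → c ≠ d → P a ∉ segment ℝ (P c) (P d) := by
    intro a c d hac had hcd h
    refine hP c a d hac.symm hcd had ?_
    exact (mem_segment_iff_wbtw.1 h).collinear
  constructor
  · intro H a b c d hab hcd hne x hx
    obtain ⟨h1, h2⟩ := hx
    have nab := hab.ne
    have ncd := hcd.ne
    by_cases hac : a = c
    · subst hac
      have hbd : b ≠ d := fun h => hne (by rw [h])
      have := key a b d x nab ncd hbd h1 h2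
      subst this; simp
    by_cases had : a = d
    · subst had
      have hbc : b ≠ c := fun h => hne (by rw [h, Sym2.eq_swap])
      rw [segment_symm] at h2
      have := key a b c x nab hac hbc h1 h2
      subst this; simp
    by_cases hbc : b = c
    · subst hbc
      rw [segment_symm] at h1
      have := key b a d x nab.symm ncd had h1 h2
      subst this; simp
    by_cases hbd : b = d
    · subst hbd
      rw [segment_symm] at h1 h2
      have := key b a c x nab.symm hbc hac h1 h2
      subst this; simp
    exfalso
    refine H a b c d hab hcd ⟨fun hcol => ?_, x, ?_, ?_⟩
    · exact hP a b c nab hac hbc (hcol.subset (by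
        intro y hy; simp only [Set.mem_insert_iff, Set.mem_singleton_iff] at hy ⊢; tauto))
    · refine mem_openSegment_of_ne_left_right ?_ ?_ h1
      · rintro rfl; exact key2 a c d hac had ncd h2
      · rintro rfl; exact key2 b c d hbc hbd ncd h2
    · refine mem_openSegment_of_ne_left_right ?_ ?_ h2
      · rintro rfl; exact key2 c a b (Ne.symm hac) (Ne.symm hbc) nab h1
      · rintro rfl; exact key2 d a b (Ne.symm had) (Ne.symm hbd) nab h1
  · rintro H a b c d hab hcd ⟨hcol, x, h1, h2⟩
    by_cases hne : s(a, b) = s(c, d)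
    · apply hcol
      have : ({P a, P b, P c, P d} : Set Plane) ⊆ {P a, P b} := by
        rcases Sym2.eq_iff.1 hne with ⟨rfl, rfl⟩ | ⟨rfl, rfl⟩ <;>
        · intro y hy
          simp only [Set.mem_insert_iff, Set.mem_singleton_iff] at hy ⊢
          tauto
      exact (collinear_pair ℝ _ _).subset this
    · have hx := H a b c d hab hcd hne
        ⟨openSegment_subset_segment ℝ _ _ h1, openSegment_subset_segment ℝ _ _ h2⟩
      have ne : ∀ u v : Fin n, u ≠ v → P u ≠ P v := by
        intro u v huv h
        by_cases hw : ∃ w, w ≠ u ∧ w ≠ v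
        · obtain ⟨w, hwu, hwv⟩ := hw
          refine hP u v w huv (Ne.symm hwu) (Ne.symm hwv) ?_
          rw [h]; simpa using collinear_pair ℝ (P v) (P w)
        · push Not at hw
          apply hne
          have e1 := hw a; have e2 := hw b; have e3 := hw c; have e4 := hw d
          have nab := hab.ne
          have ncd := hcd.ne
          rw [Sym2.eq_iff]
          grind
      rcases hx.1 with rfl | hx'
      · exact ne a b hab.ne (left_mem_openSegment_iff.1 h1)
      · rw [Set.mem_singleton_iff] at hx'
        subst hx'
        exact ne a b hab.ne (right_mem_openSegment_iff.1 h1)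

/-! ## The real RAM

Programs compute with natural numbers (used for counting and addressing) and with exact real
numbers. There are finitely many integer arrays and real arrays (those named in the program), with
computed indices. Unit-cost operations are addition and truncated subtraction of natural numbers;
`+`, `-`, `*`, `/`, `√` on real numbers; rational constants; memory access; comparisons. There is
no rounding and no conversion from real numbers to natural numbers. -/

namespace RealRAM

/-- The memory: the entry with index `i` of the integer array `A` is `int A i`, and the entry with
index `i` of the real array `A` is `real A i`. -/
structure Store where
  int : ℕ → ℕ → ℕ
  real : ℕ → ℕ → ℝ

/-- Write `v` into entry `i` of the integer array `A`. -/
def Store.setInt (s : Store) (A i v : ℕ) : Store :=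
  { s with int := Function.update s.int A (Function.update (s.int A) i v) }

/-- Write `v` into entry `i` of the real array `A`. -/
noncomputable def Store.setReal (s : Store) (A i : ℕ) (v : ℝ) : Store :=
  { s with real := Function.update s.real A (Function.update (s.real A) i v) }

/-- Integer expressions. -/
inductive IntExpr : Type
  | const (k : ℕ)
  | get (A : ℕ) (i : IntExpr)
  | add (e f : IntExpr)
  | sub (e f : IntExpr)

/-- Real expressions. -/
inductive RealExpr : Type
  | const (q : ℚ)
  | get (A : ℕ) (i : IntExpr)
  | add (e f : RealExpr)
  | sub (e f : RealExpr)
  | mul (e f : RealExpr)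
  | div (e f : RealExpr)
  | sqrt (e : RealExpr)

/-- Tests. -/
inductive Test : Type
  | intLt (e f : IntExpr)
  | realLt (e f : RealExpr)
  | neg (b : Test)
  | conj (b c : Test)

/-- Programs. -/
inductive Prog : Type
  | skip
  | setInt (A : ℕ) (i e : IntExpr)
  | setReal (A : ℕ) (i : IntExpr) (e : RealExpr)
  | seq (p q : Prog)
  | cond (b : Test) (p q : Prog)
  | loop (b : Test) (p : Prog)

/-- Value of an integer expression. -/
def IntExpr.val (s : Store) : IntExpr → ℕ
  | const k => k
  | get A i => s.int A (i.val s)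
  | add e f => e.val s + f.val s
  | sub e f => e.val s - f.val s

/-- Number of unit-cost operations in the evaluation of an integer expression. -/
def IntExpr.cost : IntExpr → ℕ
  | const _ => 1
  | get _ i => i.cost + 1
  | add e f => e.cost + f.cost + 1
  | sub e f => e.cost + f.cost + 1

/-- Value of a real expression. Division by zero and the square root of a negative number
give `0`; a program can detect both cases beforehand by a comparison. -/
noncomputable def RealExpr.val (s : Store) : RealExpr → ℝ
  | const q => (q : ℝ)
  | get A i => s.real A (i.val s)
  | add e f => e.val s + f.val s
  | sub e f => e.val s - f.val s
  | mul e f => e.val s * f.val s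
  | div e f => e.val s / f.val s
  | sqrt e => Real.sqrt (e.val s)

/-- Number of unit-cost operations in the evaluation of a real expression. -/
def RealExpr.cost : RealExpr → ℕ
  | const _ => 1
  | get _ i => i.cost + 1
  | add e f => e.cost + f.cost + 1
  | sub e f => e.cost + f.cost + 1
  | mul e f => e.cost + f.cost + 1
  | div e f => e.cost + f.cost + 1
  | sqrt e => e.cost + 1

/-- Truth of a test. -/
def Test.Holds (s : Store) : Test → Prop
  | intLt e f => e.val s < f.val s
  | realLt e f => e.val s < f.val s
  | neg b => ¬ b.Holds s
  | conj b c => b.Holds s ∧ c.Holds s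

/-- Number of unit-cost operations in the evaluation of a test. -/
def Test.cost : Test → ℕ
  | intLt e f => e.cost + f.cost + 1
  | realLt e f => e.cost + f.cost + 1
  | neg b => b.cost + 1
  | conj b c => b.cost + c.cost + 1

/-- `Exec p s t s'`: started in memory `s`, the program `p` halts after exactly `t` unit-cost
steps, and then the memory is `s'`. -/
inductive Exec : Prog → Store → ℕ → Store → Prop
  | skip (s : Store) : Exec .skip s 1 s
  | setInt (s : Store) (A : ℕ) (i e : IntExpr) :
      Exec (.setInt A i e) s (i.cost + e.cost + 1) (s.setInt A (i.val s) (e.val s))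
  | setReal (s : Store) (A : ℕ) (i : IntExpr) (e : RealExpr) :
      Exec (.setReal A i e) s (i.cost + e.cost + 1) (s.setReal A (i.val s) (e.val s))
  | seq {p q : Prog} {s s' s'' : Store} {t t' : ℕ} :
      Exec p s t s' → Exec q s' t' s'' → Exec (.seq p q) s (t + t') s''
  | condTrue {b : Test} {p q : Prog} {s s' : Store} {t : ℕ} :
      b.Holds s → Exec p s t s' → Exec (.cond b p q) s (b.cost + t + 1) s'
  | condFalse {b : Test} {p q : Prog} {s s' : Store} {t : ℕ} :
      ¬ b.Holds s → Exec q s t s' → Exec (.cond b p q) s (b.cost + t + 1) s'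
  | loopTrue {b : Test} {p : Prog} {s s' s'' : Store} {t t' : ℕ} :
      b.Holds s → Exec p s t s' → Exec (.loop b p) s' t' s'' →
        Exec (.loop b p) s (b.cost + t + t' + 1) s''
  | loopFalse {b : Test} {p : Prog} {s : Store} :
      ¬ b.Holds s → Exec (.loop b p) s (b.cost + 1) s

/-- Programs are deterministic: the result and the number of steps are determined by the input. -/
theorem Exec.deterministic {p : Prog} {s s₁ s₂ : Store} {t₁ t₂ : ℕ}
    (h₁ : Exec p s t₁ s₁) (h₂ : Exec p s t₂ s₂) : t₁ = t₂ ∧ s₁ = s₂ := by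
  induction h₁ generalizing t₂ s₂ with
  | skip s => cases h₂; exact ⟨rfl, rfl⟩
  | setInt s A i e => cases h₂; exact ⟨rfl, rfl⟩
  | setReal s A i e => cases h₂; exact ⟨rfl, rfl⟩
  | seq _ _ ih ih' =>
    cases h₂ with
    | seq a b =>
      obtain ⟨rfl, rfl⟩ := ih a
      obtain ⟨rfl, rfl⟩ := ih' b
      exact ⟨rfl, rfl⟩
  | condTrue hb _ ih =>
    cases h₂ with
    | condTrue _ a => obtain ⟨rfl, rfl⟩ := ih a; exact ⟨rfl, rfl⟩
    | condFalse hb' _ => exact absurd hb hb'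
  | condFalse hb _ ih =>
    cases h₂ with
    | condTrue hb' _ => exact absurd hb' hb
    | condFalse _ a => obtain ⟨rfl, rfl⟩ := ih a; exact ⟨rfl, rfl⟩
  | loopTrue hb _ _ ih ih' =>
    cases h₂ with
    | loopTrue _ a b =>
      obtain ⟨rfl, rfl⟩ := ih a
      obtain ⟨rfl, rfl⟩ := ih' b
      exact ⟨rfl, rfl⟩
    | loopFalse hb' => exact absurd hb hb'
  | loopFalse hb =>
    cases h₂ with
    | loopTrue hb' _ _ => exact absurd hb' hb
    | loopFalse _ => exact ⟨rfl, rfl⟩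

/-- The input memory for the points `P 0, …, P (n - 1)`: the number `n` is entry `0` of the integer
array `0`, the first and second coordinate of `P i` are entry `i` of the real arrays `0` and `1`,
and all other entries are zero. -/
noncomputable def inputStore {n : ℕ} (P : Fin n → Plane) : Store where
  int A i := if A = 0 ∧ i = 0 then n else 0
  real A i := if h : i < n then (if A = 0 then P ⟨i, h⟩ 0 else if A = 1 then P ⟨i, h⟩ 1 else 0)
    else 0

/-- The output graph: its edges are the pairs `{int 1 k, int 2 k}` with `k < n - 1`. (If this graph
is a tree, then all the `n - 1` pairs are valid and different edges.) -/
def outputGraph (n : ℕ) (s : Store) : SimpleGraph (Fin n) :=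
  SimpleGraph.fromRel fun u v => ∃ k < n - 1, s.int 1 k = u ∧ s.int 2 k = v

end RealRAM

/-! Take a diametral pair `a`, `b`, scaled to distance 1. The algorithm returns the longest of all
stars and two fans, one at `a` and one at `b`. The competitor is bounded crudely: rooting a tree at
`r` and charging each edge to its lower endpoint bounds the length by the sum over `p ≠ r` of any `φ
p` that dominates all distances from `p` (`totalLength_le_sum_erase`). Its planarity plays no role.

If some point `q` lies at height at least 0.691 over the line `ab`, then every point has distances
to `a`, `b`, `q` with sum at least `√3 / 2 + 0.691 ≥ 3 * 0.519` (`three_distances_bound`). Hence the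
stars at `a`, `b`, `q` have average length at least 0.519 per vertex, while no edge is longer than
1.

Otherwise all points lie in a flattened lens. The stars at `a` and `b` alone are too weak: a vertex
close to `a` may get only about 1 from both together, where `2 * 0.519` can be needed. The fan at
`a` joins the points beyond the bisector to `a` and every nearer point to some point beyond the
bisector. A near point with abscissa `x` thus gets an edge of length at least `1/2 - x` from the fan
at `a`, and its edge to `b` from the fan at `b`. With weight 0.9 on the two stars and 0.1 on the two
fans, every vertex other than `a`, `b` receives at least `2 * 0.519` times its distance to any other
point (`lens_mixture_bound`); summation gives the claim (`approximation_of_stars_and_fans`).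

A fan is plane because the far points cut the half-plane around `a` into wedges by slope, and each
near point is joined to a far point on the boundary of its own wedge, the same one for the whole
wedge (`IsFanMap.isPlaneParentMap`).

What remains is a program for this choice, verified with a loop-invariant rule (`forLoop_spec`) and
frame lemmas. There are `n` stars costing `O(n)` each and two fans costing `O(n ^ 2)`, so the time
is quadratic. -/

/-! ### Rooted trees given by parent maps, and an upper bound for all spanning trees -/

section ParentTrees

variable {n : ℕ}

/-- The graph in which every vertex `v` is joined to its parent `f v`. -/
def parentGraph (f : Fin n → Fin n) : SimpleGraph (Fin n) :=
  SimpleGraph.fromRel fun u v => f u = v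

/-- The parent map `f` with root `r` describes a noncrossing spanning tree of `P`. -/
structure IsPlaneParentMap (P : Fin n → Plane) (f : Fin n → Fin n) (r : Fin n) : Prop where
  root : f r = r
  rank : ∃ rk : Fin n → ℕ, ∀ v, v ≠ r → rk (f v) < rk v
  noncrossing : ∀ v w, v ≠ r → w ≠ r → ¬ SegmentsCross (P v) (P (f v)) (P w) (P (f w))

/-- The total length of the edges from the vertices to their parents. -/
noncomputable def parentLength (P : Fin n → Plane) (f : Fin n → Fin n) : ℝ :=
  ∑ v, dist (P v) (P (f v))

theorem SegmentsCross.swap_left {a b c d : Plane} (h : SegmentsCross a b c d) :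
    SegmentsCross b a c d := by
  refine ⟨?_, by rw [openSegment_symm]; exact h.2⟩
  rw [Set.insert_comm]; exact h.1

theorem SegmentsCross.symm {a b c d : Plane} (h : SegmentsCross a b c d) :
    SegmentsCross c d a b := by
  refine ⟨?_, by rw [Set.inter_comm]; exact h.2⟩
  have : ({c, d, a, b} : Set Plane) = {a, b, c, d} := by
    ext x; simp only [Set.mem_insert_iff, Set.mem_singleton_iff]; tauto
  rw [this]; exact h.1

theorem SegmentsCross.swap_right {a b c d : Plane} (h : SegmentsCross a b c d) :
    SegmentsCross a b d c :=
  h.symm.swap_left.symm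

/-- Two vertices with the same parent edge would be each other's parent, and the rank would drop
around a 2-cycle. -/
theorem parent_edge_injOn {f : Fin n → Fin n} {r : Fin n} {rk : Fin n → ℕ}
    (hrk : ∀ v, v ≠ r → rk (f v) < rk v) :
    Set.InjOn (fun v => s(v, f v)) {v | v ≠ r} := by
  intro v hv w hw h
  rcases Sym2.eq_iff.1 h with ⟨h1, -⟩ | ⟨h1, h2⟩
  · exact h1
  · have e1 := hrk v hv
    have e2 := hrk w hw
    rw [h2] at e1
    rw [← h1] at e2
    omega

theorem parentGraph_adj {f : Fin n → Fin n} {u v : Fin n} :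
    (parentGraph f).Adj u v ↔ u ≠ v ∧ (f u = v ∨ f v = u) := by
  simp [parentGraph, SimpleGraph.fromRel_adj]

theorem parentGraph_adj_self {f : Fin n → Fin n} {r : Fin n} {rk : Fin n → ℕ}
    (hrk : ∀ v, v ≠ r → rk (f v) < rk v) {v : Fin n} (hv : v ≠ r) :
    (parentGraph f).Adj v (f v) := by
  rw [parentGraph_adj]
  refine ⟨fun h => ?_, Or.inl rfl⟩
  have := hrk v hv
  rw [← h] at this
  exact lt_irrefl _ this

open Classical in
theorem edgeFinset_parentGraph {f : Fin n → Fin n} {r : Fin n} {rk : Fin n → ℕ} (hr : f r = r)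
    (hrk : ∀ v, v ≠ r → rk (f v) < rk v) :
    (parentGraph f).edgeFinset = (Finset.univ.erase r).image fun v => s(v, f v) := by
  ext e
  induction e using Sym2.ind with
  | _ x y =>
    simp only [SimpleGraph.mem_edgeFinset, SimpleGraph.mem_edgeSet, Finset.mem_image,
      Finset.mem_erase, Finset.mem_univ, and_true]
    constructor
    · intro h
      obtain ⟨hne, h | h⟩ := parentGraph_adj.1 h
      · exact ⟨x, fun e => hne (by rw [← h, e, hr]), by rw [h]⟩
      · exact ⟨y, fun e => hne (by rw [← h, e, hr]), by rw [h, Sym2.eq_swap]⟩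
    · rintro ⟨v, hv, e⟩
      rw [← SimpleGraph.mem_edgeSet, ← e, SimpleGraph.mem_edgeSet]
      exact parentGraph_adj_self hrk hv

theorem IsPlaneParentMap.isNoncrossingSpanningTree {P : Fin n → Plane} {f : Fin n → Fin n}
    {r : Fin n} (h : IsPlaneParentMap P f r) : IsNoncrossingSpanningTree P (parentGraph f) := by
  classical
  obtain ⟨rk, hrk⟩ := h.rank
  refine ⟨?_, ?_⟩
  · rw [SimpleGraph.isTree_iff_connected_and_card]
    constructor
    -- Following parents lowers the rank until the root is reached.
    · have key : ∀ k, ∀ v, rk v ≤ k → (parentGraph f).Reachable v r := by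
        intro k
        induction k with
        | zero =>
          intro v hv
          by_cases hvr : v = r
          · rw [hvr]
          · have := hrk v hvr; omega
        | succ k ih =>
          intro v hv
          by_cases hvr : v = r
          · rw [hvr]
          · have := hrk v hvr
            exact (parentGraph_adj_self hrk hvr).reachable.trans (ih _ (by omega))
      have : Nonempty (Fin n) := ⟨r⟩
      exact ⟨fun u v => (key _ u le_rfl).trans (key _ v le_rfl).symm⟩
    · rw [Nat.card_eq_fintype_card, ← SimpleGraph.edgeFinset_card,
        edgeFinset_parentGraph h.root hrk, Finset.card_image_of_injOn, Finset.card_erase_of_mem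
        (Finset.mem_univ _), Finset.card_univ, Nat.card_eq_fintype_card]
      · have := Fintype.card_pos_iff.2 ⟨r⟩
        omega
      · intro v hv w hw
        exact parent_edge_injOn hrk (by simpa using hv) (by simpa using hw)
  · have hnr : ∀ a b, (parentGraph f).Adj a b → f a = b → a ≠ r := by
      rintro a b hab e rfl
      exact hab.ne (by rw [← e, h.root])
    intro a b c d hab hcd hx
    obtain ⟨-, e | e⟩ := parentGraph_adj.1 hab <;> obtain ⟨-, e' | e'⟩ := parentGraph_adj.1 hcd
    · have := h.noncrossing a c (hnr a b hab e) (hnr c d hcd e')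
      rw [e, e'] at this; exact this hx
    · have := h.noncrossing a d (hnr a b hab e) (hnr d c hcd.symm e')
      rw [e, e'] at this; exact this hx.swap_right
    · have := h.noncrossing b c (hnr b a hab.symm e) (hnr c d hcd e')
      rw [e, e'] at this; exact this hx.swap_left
    · have := h.noncrossing b d (hnr b a hab.symm e) (hnr d c hcd.symm e')
      rw [e, e'] at this; exact this hx.swap_left.swap_right

theorem IsPlaneParentMap.totalLength_eq {P : Fin n → Plane} {f : Fin n → Fin n}
    {r : Fin n} (h : IsPlaneParentMap P f r) :
    totalLength P (parentGraph f) = parentLength P f := by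
  classical
  obtain ⟨rk, hrk⟩ := h.rank
  unfold totalLength parentLength
  have e := edgeFinset_parentGraph h.root hrk
  rw [show (∑ v, dist (P v) (P (f v))) = ∑ v ∈ Finset.univ.erase r, dist (P v) (P (f v)) by
    rw [Finset.sum_erase]; rw [h.root, dist_self]]
  rw [show (∑ v ∈ Finset.univ.erase r, dist (P v) (P (f v))) =
    ∑ e ∈ (Finset.univ.erase r).image (fun v => s(v, f v)),
      Sym2.lift ⟨fun u v => dist (P u) (P v), fun _ _ => dist_comm _ _⟩ e by
    rw [Finset.sum_image]
    · rfl
    · intro v hv w hw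
      exact parent_edge_injOn hrk (by simpa using hv) (by simpa using hw)]
  rw [← e]

/-- The length of a spanning tree is at most the sum of bounds for the edges at the vertices,
where one vertex may be left out. -/
theorem totalLength_le_sum_erase {P : Fin n → Plane} {T : SimpleGraph (Fin n)} (hT : T.IsTree)
    (r : Fin n) (φ : Fin n → ℝ) (hφ : ∀ p q, dist (P p) (P q) ≤ φ p) :
    totalLength P T ≤ ∑ p ∈ Finset.univ.erase r, φ p := by
  classical
  have hc := hT.connected
  -- The first step of a shortest path to `r` serves as the parent, with the graph distance to `r`
  -- as rank. The resulting edges are distinct and number `n - 1`, so they are all the edges of `T`.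
  have hex : ∀ v, ∃ u, v ≠ r → T.Adj v u ∧ T.dist u r < T.dist v r := by
    intro v
    by_cases hv : v = r
    · exact ⟨v, fun h => absurd hv h⟩
    · obtain ⟨p, hp⟩ := hc.exists_walk_length_eq_dist v r
      cases p with
      | nil => exact absurd rfl hv
      | cons hadj q =>
        refine ⟨_, fun _ => ⟨hadj, ?_⟩⟩
        rw [← hp, SimpleGraph.Walk.length_cons]
        exact Nat.lt_succ_of_le (SimpleGraph.dist_le q)
  choose g hg using hex
  have hinj := parent_edge_injOn (f := g) (r := r) (rk := fun v => T.dist v r)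
    fun v hv => (hg v hv).2
  have hinj' : Set.InjOn (fun v => s(v, g v)) ((Finset.univ.erase r : Finset (Fin n)) : Set _) := by
    intro v hv w hw
    exact hinj (by simpa using hv) (by simpa using hw)
  have himg : (Finset.univ.erase r).image (fun v => s(v, g v)) = T.edgeFinset := by
    apply Finset.eq_of_subset_of_card_le
    · intro e he
      obtain ⟨v, hv, rfl⟩ := Finset.mem_image.1 he
      rw [SimpleGraph.mem_edgeFinset, SimpleGraph.mem_edgeSet]
      exact (hg v (Finset.ne_of_mem_erase hv)).1
    · rw [Finset.card_image_of_injOn hinj', Finset.card_erase_of_mem (Finset.mem_univ _),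
        Finset.card_univ, ← hT.card_edgeFinset]
      simp
  unfold totalLength
  have : ∀ S : Finset (Sym2 (Fin n)), S = T.edgeFinset →
    ∑ e ∈ S, Sym2.lift ⟨fun u v => dist (P u) (P v), fun _ _ => dist_comm _ _⟩ e ≤
      ∑ p ∈ Finset.univ.erase r, φ p := by
    rintro S rfl
    rw [← himg, Finset.sum_image hinj']
    exact Finset.sum_le_sum fun v _ => hφ v (g v)
  apply this
  congr!

end ParentTrees

/-! ### Inequalities in the lens over the unit segment -/

section LensInequalities

/-- A point of the lens between two unit circles with bounded height. -/
theorem lens_height_bound {X Y : ℝ} (h0 : X ^ 2 + Y ^ 2 ≤ 1) (h1 : (1 - X) ^ 2 + Y ^ 2 ≤ 1)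
    (hY : |Y| ≤ 0.691) : X ^ 2 + Y ^ 2 - X ≤ 1 - 0.7228 := by
  have hY2 : Y ^ 2 ≤ 0.691 ^ 2 := sq_le_sq' (abs_le.1 hY).1 (abs_le.1 hY).2
  -- The constant is just below `√(1 - 0.691 ^ 2)`, the abscissa at which height 0.691 meets the
  -- unit circle. Near either end one circle suffices; in between `X * (1 - X)` exceeds `0.7228 * (1
  -- - 0.7228)`, and `0.691 ^ 2 + 0.7228 ^ 2 ≤ 1` finishes.
  by_cases hX : 0.7228 ≤ X
  · linarith
  by_cases hX' : 0.7228 ≤ 1 - X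
  · nlinarith
  push Not at hX hX'
  nlinarith [mul_pos (sub_pos.2 hX) (sub_pos.2 hX')]

/-- Cauchy–Schwarz against a unit vector. It replaces each norm by a linear lower bound, with the
direction chosen to be nearly tight where needed. -/
theorem dot_le_sqrt {u v x y : ℝ} (huv : u ^ 2 + v ^ 2 = 1) :
    u * x + v * y ≤ √(x ^ 2 + y ^ 2) := by
  apply Real.le_sqrt_of_sq_le
  nlinarith [sq_nonneg (u * y - v * x)]

theorem lens_mixture_bound_aux {x y E : ℝ} (hx0 : 0 ≤ x) (hx1 : x ≤ 1 / 2) (hy0 : 0 ≤ y)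
    (hy1 : y ≤ 0.691) (hE : E ^ 2 ≤ 1)
    (hED : E ^ 2 ≤ 1 - 2 * 0.7228 * x + x ^ 2 + y ^ 2 + 2 * 0.691 * y) :
    2 * 0.519 * E ≤ 0.9 * (√(x ^ 2 + y ^ 2) + √((1 - x) ^ 2 + y ^ 2)) +
      0.1 * (√((1 - x) ^ 2 + y ^ 2) + (1 / 2 - x)) := by
  have hEle : E ≤ 1 := by nlinarith
  -- The tangent of the square root at 1 turns the bound on `E ^ 2` into one on `E`.
  have hE2 : E ≤ (1 + E ^ 2) / 2 := by nlinarith [sq_nonneg (1 - E)]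
  -- Since `E ^ 2 - 1 ≤ 0`, its coefficient `0.519 / 2` may be lowered to any `k ≥ 0`. This
  -- interpolates between the two hypotheses on `E ^ 2`; `k` is tuned to the range of `y`.
  have finish : ∀ k : ℝ, 0 ≤ k → k ≤ 0.519 / 2 →
      2 * 0.519 + 2 * k * (-2 * 0.7228 * x + x ^ 2 + y ^ 2 + 2 * 0.691 * y) ≤
      0.9 * (√(x ^ 2 + y ^ 2) + √((1 - x) ^ 2 + y ^ 2)) +
      0.1 * (√((1 - x) ^ 2 + y ^ 2) + (1 / 2 - x)) →
      2 * 0.519 * E ≤ 0.9 * (√(x ^ 2 + y ^ 2) + √((1 - x) ^ 2 + y ^ 2)) +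
      0.1 * (√((1 - x) ^ 2 + y ^ 2) + (1 / 2 - x)) := by
    intro k hk0 hk1 h
    refine le_trans ?_ h
    have h1 : k * (E ^ 2 - 1) ≤ k * (-2 * 0.7228 * x + x ^ 2 + y ^ 2 + 2 * 0.691 * y) :=
      mul_le_mul_of_nonneg_left (by linarith) hk0
    have h2 : 0.519 / 2 * (E ^ 2 - 1) ≤ k * (E ^ 2 - 1) :=
      mul_le_mul_of_nonpos_right hk1 (by linarith)
    linarith
  -- In each range, rational unit vectors make the right side linear. The left side is convex in `x`
  -- and in `y`, so the products given as hints bound the squares by chords over the ranges.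
  rcases le_total y 0.14 with hy | hy
  · refine finish 0.2 (by norm_num) (by norm_num) ?_
    have hr := dot_le_sqrt (u := 4 / 5) (v := 3 / 5) (x := x) (y := y) (by norm_num)
    have hs := dot_le_sqrt (u := 1) (v := 0) (x := 1 - x) (y := y) (by norm_num)
    nlinarith [mul_nonneg hx0 (sub_nonneg.2 hx1), mul_nonneg hy0 (sub_nonneg.2 hy)]
  · refine finish 0.125 (by norm_num) (by norm_num) ?_
    have hr := dot_le_sqrt (u := 12 / 13) (v := 5 / 13) (x := x) (y := y) (by norm_num)
    have hs := dot_le_sqrt (u := 40 / 41) (v := 9 / 41) (x := 1 - x) (y := y) (by norm_num)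
    nlinarith [mul_nonneg hx0 (sub_nonneg.2 hx1), mul_nonneg (sub_nonneg.2 hy) (sub_nonneg.2 hy1)]

/-- For a point `(x, y)` in the left half of the lens of the unit segment, a mixture of its
distances to the endpoints and to the bisector bounds the distance to any other point `(X, Y)` of
the lens, provided that the heights of both points are bounded. -/
theorem lens_mixture_bound {x y X Y : ℝ} (hx1 : x ≤ 1 / 2)
    (h1 : (1 - x) ^ 2 + y ^ 2 ≤ 1) (hy : |y| ≤ 0.691)
    (H0 : X ^ 2 + Y ^ 2 ≤ 1) (H1 : (1 - X) ^ 2 + Y ^ 2 ≤ 1) (hY : |Y| ≤ 0.691)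
    (hD : (x - X) ^ 2 + (y - Y) ^ 2 ≤ 1) :
    2 * 0.519 * √((x - X) ^ 2 + (y - Y) ^ 2) ≤
      0.9 * (√(x ^ 2 + y ^ 2) + √((1 - x) ^ 2 + y ^ 2)) +
      0.1 * (√((1 - x) ^ 2 + y ^ 2) + (1 / 2 - x)) := by
  have hx0 : 0 ≤ x := by nlinarith [sq_nonneg y]
  have hn : 0 ≤ (x - X) ^ 2 + (y - Y) ^ 2 := by positivity
  have hyY : -(y * Y) ≤ |y| * 0.691 := by
    calc -(y * Y) ≤ |y * Y| := neg_le_abs _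
      _ = |y| * |Y| := abs_mul _ _
      _ ≤ |y| * 0.691 := mul_le_mul_of_nonneg_left hY (abs_nonneg _)
  -- The squared distance equals `x² + y² + (1 - 2x)(X² + Y²) + 2x(X² + Y² - X) - 2yY`; `e2`, `e1`
  -- and `hyY` bound the last three terms.
  have hL := lens_height_bound H0 H1 hY
  have e1 := mul_le_mul_of_nonneg_left hL hx0
  have e2 := mul_le_mul_of_nonneg_left H0 (show 0 ≤ 1 - 2 * x by linarith)
  have := lens_mixture_bound_aux (x := x) (y := |y|) (E := √((x - X) ^ 2 + (y - Y) ^ 2)) hx0 hx1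
    (abs_nonneg _) hy (by rwa [Real.sq_sqrt hn]) (by rw [Real.sq_sqrt hn, sq_abs]; nlinarith)
  simpa only [sq_abs] using this

/-- If `(X, Y)` is high above the unit segment, then the sum of the distances of any point to the
endpoints and to `(X, Y)` is large. -/
theorem three_distances_bound {x y X Y : ℝ} (hY : 0.691 ≤ |Y|) :
    3 * 0.519 ≤ √(x ^ 2 + y ^ 2) + √((1 - x) ^ 2 + y ^ 2) + √((x - X) ^ 2 + (y - Y) ^ 2) := by
  have h3 : √3 ^ 2 = 3 := Real.sq_sqrt (by norm_num)
  have h3' : 1.73204 ≤ √3 := Real.le_sqrt_of_sq_le (by norm_num)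
  rcases le_abs.1 hY with h | h
  -- Three unit vectors at mutual angles of 120 degrees sum to zero, so `x` and `y` cancel and `√3 /
  -- 2 + |Y|` remains. The threshold 0.691 is `3 * 0.519 - √3 / 2` rounded up.
  · have e1 := dot_le_sqrt (u := √3 / 2) (v := 1 / 2) (x := x) (y := y) (by nlinarith)
    have e2 := dot_le_sqrt (u := √3 / 2) (v := 1 / 2) (x := 1 - x) (y := y) (by nlinarith)
    have e3 := dot_le_sqrt (u := 0) (v := -1) (x := x - X) (y := y - Y) (by norm_num)
    linarith
  · have e1 := dot_le_sqrt (u := √3 / 2) (v := -1 / 2) (x := x) (y := y) (by nlinarith)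
    have e2 := dot_le_sqrt (u := √3 / 2) (v := -1 / 2) (x := 1 - x) (y := y) (by nlinarith)
    have e3 := dot_le_sqrt (u := 0) (v := 1) (x := x - X) (y := y - Y) (by norm_num)
    linarith

end LensInequalities

/-! ### Fans at a diametral pair and their planarity -/

section Fan

/-- The scaled coordinate of `z` along the direction from `a` to `b`. -/
noncomputable def along (a b z : Plane) : ℝ :=
  (b 0 - a 0) * (z 0 - a 0) + (b 1 - a 1) * (z 1 - a 1)

/-- The scaled coordinate of `z` across the direction from `a` to `b`. -/
noncomputable def across (a b z : Plane) : ℝ :=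
  (b 0 - a 0) * (z 1 - a 1) - (b 1 - a 1) * (z 0 - a 0)

theorem dist_sq_eq (p q : Plane) : dist p q ^ 2 = (p 0 - q 0) ^ 2 + (p 1 - q 1) ^ 2 := by
  rw [EuclideanSpace.dist_sq_eq, Fin.sum_univ_two, Real.dist_eq, Real.dist_eq, sq_abs, sq_abs]

theorem along_self (a b : Plane) : along a b b = dist a b ^ 2 := by
  rw [dist_sq_eq]; unfold along; ring

theorem not_segmentsCross_common (p q r : Plane) : ¬ SegmentsCross p q p r := by
  rintro ⟨hcol, z, ⟨s, t, hs, ht, hst, e⟩, ⟨s', t', hs', ht', hst', e'⟩⟩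
  apply hcol
  have hp : p ∈ ({p, q, p, r} : Set Plane) := by simp
  rw [collinear_iff_of_mem hp]
  refine ⟨r - p, ?_⟩
  intro x hx
  simp only [Set.mem_insert_iff, Set.mem_singleton_iff] at hx
  rcases hx with rfl | rfl | rfl | rfl
  · exact ⟨0, by simp⟩
  -- The common point `z` satisfies `z - p = t • (q - p) = t' • (r - p)` with `t > 0`.
  · refine ⟨t' / t, ?_⟩
    have h : s • p + t • x = s' • p + t' • r := e.trans e'.symm
    ext i
    have hi := congrArg (fun v : Plane => v i) h
    simp only [PiLp.add_apply, PiLp.smul_apply, smul_eq_mul, vadd_eq_add, PiLp.sub_apply] at hi ⊢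
    obtain rfl : s = 1 - t := by linarith
    obtain rfl : s' = 1 - t' := by linarith
    field_simp
    linarith
  · exact ⟨0, by simp⟩
  · exact ⟨1, by simp⟩

/-- The zero set of this functional is the line through `a` of slope `σ` in the frame of `ab`; its
direction is `b - a` plus `σ` times the rotated vector. -/
theorem collinear_of_across_eq {a b : Plane} (hab : a ≠ b) (σ : ℝ) {s : Set Plane}
    (hs : ∀ p ∈ s, across a b p - σ * along a b p = 0) : Collinear ℝ s := by
  have hD : 0 < dist a b ^ 2 := by have := dist_pos.2 hab; positivity
  have hD' := dist_sq_eq a b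
  rw [collinear_iff_exists_forall_eq_smul_vadd]
  refine ⟨a, !₂[(b 0 - a 0) - σ * (b 1 - a 1), (b 1 - a 1) + σ * (b 0 - a 0)], fun p hp => ?_⟩
  refine ⟨along a b p / dist a b ^ 2, ?_⟩
  have h := hs p hp
  have hne := hD.ne'
  ext i
  fin_cases i
  · change p 0 = along a b p / dist a b ^ 2 * ((b 0 - a 0) - σ * (b 1 - a 1)) + a 0
    rw [← sub_eq_iff_eq_add, div_mul_eq_mul_div, eq_div_iff hne, hD']
    unfold across along at *
    linear_combination -(b 1 - a 1) * h
  · change p 1 = along a b p / dist a b ^ 2 * ((b 1 - a 1) + σ * (b 0 - a 0)) + a 1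
    rw [← sub_eq_iff_eq_add, div_mul_eq_mul_div, eq_div_iff hne, hD']
    unfold across along at *
    linear_combination (b 0 - a 0) * h

theorem across_sub_combo (a b p q : Plane) (σ s t : ℝ) (hst : s + t = 1) :
    across a b (s • p + t • q) - σ * along a b (s • p + t • q) =
      s * (across a b p - σ * along a b p) + t * (across a b q - σ * along a b q) := by
  obtain rfl : s = 1 - t := by linarith
  simp only [across, along, PiLp.add_apply, PiLp.smul_apply, smul_eq_mul]
  ring

/-- By polarisation `2 * along a b z` is `|ab|² + |za|² - |zb|²`. Thus all points but `a` lie in an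
open half-plane and have finite slopes from `a`. -/
theorem along_pos {a b z : Plane} (hz : z ≠ a) (h : dist z b ≤ dist a b) : 0 < along a b z := by
  have h1 : dist z b ^ 2 ≤ dist a b ^ 2 := by gcongr
  have h2 : 0 < dist z a ^ 2 := by have := dist_pos.2 hz; positivity
  rw [dist_sq_eq] at h1 h2
  rw [dist_sq_eq] at h1
  unfold along
  nlinarith

/-- The entry `cur` is the result of the search, among the indices `j < k` with `far j`, for the
first one of smallest slope `S j ≥ σ`, where `t` is returned if there is none below `S t`. -/
def IsFanTarget (far : ℕ → Prop) (S : ℕ → ℝ) (t : ℕ) (σ : ℝ) (k cur : ℕ) : Prop :=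
  (cur = t ∨ cur < k ∧ far cur ∧ σ ≤ S cur ∧ S cur < S t ∧
    ∀ j < k, far j → S j = S cur → cur ≤ j) ∧
  ∀ j < k, far j → σ ≤ S j → S cur ≤ S j

theorem isFanTarget_zero (far : ℕ → Prop) (S : ℕ → ℝ) (t : ℕ) (σ : ℝ) :
    IsFanTarget far S t σ 0 t :=
  ⟨Or.inl rfl, fun j hj => absurd hj (Nat.not_lt_zero j)⟩

theorem IsFanTarget.le_top {far : ℕ → Prop} {S : ℕ → ℝ} {t : ℕ} {σ : ℝ} {k cur : ℕ}
    (h : IsFanTarget far S t σ k cur) : S cur ≤ S t := by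
  rcases h.1 with rfl | h
  · exact le_rfl
  · exact h.2.2.2.1.le

/-- An earlier admissible index with the slope of `k` would already have forced `S cur ≤ S k`, so
`k` is the first of its slope. This and `IsFanTarget.stay` are the two branches of the search loop.
-/
theorem IsFanTarget.step {far : ℕ → Prop} {S : ℕ → ℝ} {t : ℕ} {σ : ℝ} {k cur : ℕ}
    (h : IsFanTarget far S t σ k cur) (hk : far k ∧ ¬ S k < σ ∧ S k < S cur) :
    IsFanTarget far S t σ (k + 1) k := by
  obtain ⟨h1, h2, h3⟩ := hk
  have ht := h.le_top
  refine ⟨Or.inr ⟨Nat.lt_succ_self k, h1, not_lt.1 h2, h3.trans_le ht, fun j hj hf e => ?_⟩,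
    fun j hj hf hσ => ?_⟩
  · rcases Nat.lt_succ_iff_lt_or_eq.1 hj with hj | rfl
    · have := h.2 j hj hf (by rw [e]; exact not_lt.1 h2)
      linarith
    · exact le_rfl
  · rcases Nat.lt_succ_iff_lt_or_eq.1 hj with hj | rfl
    · exact h3.le.trans (h.2 j hj hf hσ)
    · exact le_rfl

theorem IsFanTarget.stay {far : ℕ → Prop} {S : ℕ → ℝ} {t : ℕ} {σ : ℝ} {k cur : ℕ}
    (h : IsFanTarget far S t σ k cur) (hk : ¬ (far k ∧ ¬ S k < σ ∧ S k < S cur)) :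
    IsFanTarget far S t σ (k + 1) cur := by
  refine ⟨?_, fun j hj hf hσ => ?_⟩
  · rcases h.1 with e | ⟨h0, h1, h2, h3, h4⟩
    · exact Or.inl e
    refine Or.inr ⟨by omega, h1, h2, h3, fun j hj hf e => ?_⟩
    rcases Nat.lt_succ_iff_lt_or_eq.1 hj with hj | rfl
    · exact h4 j hj hf e
    · exact h0.le
  · rcases Nat.lt_succ_iff_lt_or_eq.1 hj with hj | rfl
    · exact h.2 j hj hf hσ
    · by_contra hc
      exact hk ⟨hf, not_lt.2 hσ, not_le.1 hc⟩

theorem IsFanTarget.far_of {far : ℕ → Prop} {S : ℕ → ℝ} {t : ℕ} {σ : ℝ} {k cur : ℕ}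
    (h : IsFanTarget far S t σ k cur) (ht : far t) : far cur := by
  rcases h.1 with rfl | h
  · exact ht
  · exact h.2.1

theorem IsFanTarget.lt_of {far : ℕ → Prop} {S : ℕ → ℝ} {t : ℕ} {σ : ℝ} {k cur : ℕ}
    (h : IsFanTarget far S t σ k cur) (ht : t < k) : cur < k := by
  rcases h.1 with rfl | h
  · exact ht
  · exact h.1

/-- The tie-breaking rule makes the target a function of its slope, so near points in one wedge
share a parent even if several far points lie on the bounding ray. -/
theorem IsFanTarget.unique {far : ℕ → Prop} {S : ℕ → ℝ} {t : ℕ} {σ σ' : ℝ} {k c c' : ℕ}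
    (h : IsFanTarget far S t σ k c) (h' : IsFanTarget far S t σ' k c') (e : S c = S c') :
    c = c' := by
  rcases h.1 with rfl | ⟨h0, h1, -, h3, h4⟩ <;> rcases h'.1 with rfl | ⟨h0', h1', -, h3', h4'⟩
  · rfl
  · linarith
  · linarith
  · exact le_antisymm (h4 c' h0' h1' e.symm) (h4' c h0 h1 e)

variable {n : ℕ}

/-- The parent map `f` joins the points far from `P a` to `P a`, and every other point to the far
point that is next to it in the order of the slopes. -/
structure IsFanMap (P : Fin n → Plane) (a b : Fin n) (f : Fin n → Fin n) : Prop where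
  root : f a = a
  far : ∀ v, ¬ along (P a) (P b) (P v) < along (P a) (P b) (P b) / 2 → f v = a
  near : ∃ (S : ℕ → ℝ) (far : ℕ → Prop) (t : Fin n),
    (∀ v : Fin n, S v = across (P a) (P b) (P v) / along (P a) (P b) (P v)) ∧
    (∀ v : Fin n, far v ↔ ¬ along (P a) (P b) (P v) < along (P a) (P b) (P b) / 2) ∧
    far t ∧ (∀ v : Fin n, far v → S v ≤ S t) ∧
    ∀ v, v ≠ a → ¬ far v → IsFanTarget far S t (S v) n (f v)

theorem IsFanMap.isPlaneParentMap {P : Fin n → Plane} (hP : Function.Injective P) {a b : Fin n}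
    (hab : a ≠ b) (hd : ∀ v, dist (P v) (P b) ≤ dist (P a) (P b)) {f : Fin n → Fin n}
    (hf : IsFanMap P a b f) : IsPlaneParentMap P f a := by
  obtain ⟨S, far, t, hS, hfar, htf, hts, hw⟩ := hf.near
  have hX : ∀ v, v ≠ a → 0 < along (P a) (P b) (P v) := fun v hv =>
    along_pos (fun e => hv (hP e)) (hd v)
  have hD : 0 < along (P a) (P b) (P b) := hX b hab.symm
  have haX : along (P a) (P b) (P a) = 0 := by simp [along]
  have hafar : ¬ far a := by rw [hfar, haX]; push Not; linarith
  have hfa : ∀ v : Fin n, far v → f v = a := fun v hv => hf.far v ((hfar v).1 hv)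
  have hw2 : ∀ v, v ≠ a → ¬ far v → far (f v) := fun v h1 h2 => (hw v h1 h2).far_of htf
  have hne : P a ≠ P b := fun e => hab (hP e)
  -- the affine functional that vanishes on the ray of slope `σ`
  set g : ℝ → Plane → ℝ := fun σ z =>
    across (P a) (P b) z - σ * along (P a) (P b) z with hg
  have hgS : ∀ v, v ≠ a → ∀ σ, g σ (P v) = (S v - σ) * along (P a) (P b) (P v) := by
    intro v hv σ
    have := (hX v hv).ne'
    simp only [hg]
    rw [hS]; field_simp
  have hga : ∀ σ, g σ (P a) = 0 := by
    intro σ; simp [hg, across, along]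
  have hcomb : ∀ σ s t' p q, s + t' = 1 → g σ (s • p + t' • q) = s * g σ p + t' * g σ q :=
    fun σ s t' p q h => across_sub_combo _ _ _ _ _ _ _ h
  -- The edge from `u` to `a` lies on the ray of slope `S u`. An edge `v`, `f v` stays on one side
  -- of this ray: no far slope is skipped between a near point and its target. If `v` lies on the
  -- ray, a common point forces `f v` onto it too, and collinear overlap is no crossing.
  have mixed : ∀ u v, u ≠ a → v ≠ a → far u → ¬ far v →
      ¬ SegmentsCross (P u) (P a) (P v) (P (f v)) := by
    rintro u v hu hv hfu hfv ⟨hcol, z, ⟨s, s', hs, hs', hss, e⟩, ⟨r, r', hr, hr', hrr, e'⟩⟩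
    have hwv := hw v hv hfv
    have hwa : f v ≠ a := fun e => hafar (e ▸ hw2 v hv hfv)
    have z0 : g (S u) z = 0 := by
      rw [← e, hcomb _ _ _ _ _ hss, hga, hgS u hu]; ring
    have z1 : r * ((S v - S u) * along (P a) (P b) (P v)) +
        r' * ((S (f v) - S u) * along (P a) (P b) (P (f v))) = 0 := by
      rw [← hgS v hv, ← hgS _ hwa, ← hcomb _ _ _ _ _ hrr, e', z0]
    have hXv := hX v hv
    have hXw := hX _ hwa
    rcases lt_trichotomy (S v) (S u) with h | h | h
    · have h1 : S (f v) ≤ S u := hwv.2 u u.2 hfu h.le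
      have : r * ((S v - S u) * along (P a) (P b) (P v)) < 0 :=
        mul_neg_of_pos_of_neg hr (mul_neg_of_neg_of_pos (by linarith) hXv)
      have : r' * ((S (f v) - S u) * along (P a) (P b) (P (f v))) ≤ 0 :=
        mul_nonpos_of_nonneg_of_nonpos hr'.le
          (mul_nonpos_of_nonpos_of_nonneg (by linarith) hXw.le)
      linarith
    · have h1 : S (f v) = S u := by
        rw [h, sub_self, zero_mul, mul_zero, zero_add] at z1
        have := (mul_eq_zero.1 ((mul_eq_zero.1 z1).resolve_left hr'.ne')).resolve_right hXw.ne'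
        linarith
      apply hcol
      apply collinear_of_across_eq hne (S u)
      intro p hp
      simp only [Set.mem_insert_iff, Set.mem_singleton_iff] at hp
      change g (S u) p = 0
      rcases hp with rfl | rfl | rfl | rfl
      · rw [hgS u hu]; ring
      · exact hga _
      · rw [hgS v hv, h]; ring
      · rw [hgS _ hwa, h1]; ring
    · have h1 : S u ≤ S (f v) := by
        rcases hwv.1 with e | ⟨-, -, h1, -⟩
        · rw [e]; exact hts u hfu
        · exact h.le.trans h1
      have : 0 < r * ((S v - S u) * along (P a) (P b) (P v)) :=
        mul_pos hr (mul_pos (by linarith) hXv)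
      have : 0 ≤ r' * ((S (f v) - S u) * along (P a) (P b) (P (f v))) :=
        mul_nonneg hr'.le (mul_nonneg (by linarith) hXw.le)
      linarith
  -- The ray through the lower target `f u` separates the edges. It is not the top one, so `u` lies
  -- weakly below it; `v` lies strictly above, since otherwise `f u` would have been a better target
  -- for `v`.
  have outer : ∀ u v, u ≠ a → v ≠ a → ¬ far u → ¬ far v → S (f u) < S (f v) →
      ¬ SegmentsCross (P u) (P (f u)) (P v) (P (f v)) := by
    rintro u v hu hv hfu hfv hlt ⟨-, z, ⟨s, s', hs, hs', hss, e⟩, ⟨r, r', hr, hr', hrr, e'⟩⟩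
    have hwu := hw u hu hfu
    have hwv := hw v hv hfv
    have hua : f u ≠ a := fun e => hafar (e ▸ hw2 u hu hfu)
    have hva : f v ≠ a := fun e => hafar (e ▸ hw2 v hv hfv)
    have h1 : S u ≤ S (f u) := by
      rcases hwu.1 with e | ⟨-, -, h1, -⟩
      · have := hwv.le_top
        rw [e] at hlt; linarith
      · exact h1
    have h2 : S (f u) < S v := by
      by_contra hc
      have := hwv.2 (f u) (f u).2 (hw2 u hu hfu) (not_lt.1 hc)
      linarith
    have z0 : g (S (f u)) z ≤ 0 := by
      rw [← e, hcomb _ _ _ _ _ hss, hgS u hu, hgS _ hua]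
      have := mul_nonpos_of_nonneg_of_nonpos hs.le
        (mul_nonpos_of_nonpos_of_nonneg (sub_nonpos.2 h1) (hX u hu).le)
      linarith
    have z1 : 0 < g (S (f u)) z := by
      rw [← e', hcomb _ _ _ _ _ hrr, hgS v hv, hgS _ hva]
      exact add_pos (mul_pos hr (mul_pos (sub_pos.2 h2) (hX v hv)))
        (mul_pos hr' (mul_pos (sub_pos.2 hlt) (hX _ hva)))
    linarith
  classical
  refine ⟨hf.root, ⟨fun v => if v = a then 0 else if far v then 1 else 2, fun v hv => ?_⟩, ?_⟩
  · by_cases h : far v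
    · simp [hfa v h, hv, h]
    · have := hw2 v hv h
      by_cases h2 : f v = a <;> simp [hv, h, this, h2]
  · intro u v hu hv
    by_cases h1 : far u <;> by_cases h2 : far v
    · rw [hfa u h1, hfa v h2]
      exact fun h => not_segmentsCross_common _ _ _ h.swap_left.swap_right
    · rw [hfa u h1]; exact mixed u v hu hv h1 h2
    · rw [hfa v h2]; exact fun h => mixed v u hv hu h2 h1 h.symm
    · rcases lt_trichotomy (S (f u)) (S (f v)) with h | h | h
      · exact outer u v hu hv h1 h2 h
      · have : f u = f v := Fin.ext ((hw u hu h1).unique (hw v hv h2) h)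
        rw [this]
        exact fun h => not_segmentsCross_common _ _ _ h.swap_left.swap_right
      · exact fun hx => outer v u hv hu h2 h1 h hx.symm

theorem star_isPlaneParentMap (P : Fin n → Plane) (c : Fin n) :
    IsPlaneParentMap P (fun _ => c) c where
  root := rfl
  rank := ⟨fun v => if v = c then 0 else 1, fun v hv => by simp [hv]⟩
  noncrossing := fun _ _ _ _ h => not_segmentsCross_common _ _ _ h.swap_left.swap_right

end Fan

/-! ### The approximation ratio -/

section Approximation

theorem along_swap (a b z : Plane) : along b a z = dist a b ^ 2 - along a b z := by
  rw [dist_sq_eq]; unfold along; ring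

theorem across_swap (a b z : Plane) : across b a z = -across a b z := by
  unfold across; ring

/-- In the orthogonal frame with origin `a` and unit vector `b - a`, the coordinates are `along` and
`across` divided by the square of `dist a b`. This transfers the unit-segment inequalities to any
pair. -/
theorem dist_eq_mul_sqrt {a b : Plane} (hab : a ≠ b) (v w : Plane) :
    dist v w = dist a b * √((along a b v / dist a b ^ 2 - along a b w / dist a b ^ 2) ^ 2 +
      (across a b v / dist a b ^ 2 - across a b w / dist a b ^ 2) ^ 2) := by
  have hd := dist_pos.2 hab
  have hD := dist_sq_eq a b
  rw [← Real.sqrt_sq (dist_nonneg (x := v) (y := w)), ← Real.sqrt_sq hd.le,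
    ← Real.sqrt_mul (by positivity), Real.sqrt_sq hd.le]
  congr 1
  have hne : dist a b ^ 2 ≠ 0 := by positivity
  rw [← sub_div, ← sub_div, div_pow, div_pow, ← add_div, mul_div_assoc', eq_div_iff (by positivity),
    sq (dist a b ^ 2), ← mul_assoc, mul_comm]
  congr 1
  rw [dist_sq_eq v w, hD]
  unfold along across
  ring

/-- The three stars centred at `a`, `b` and a high point `q` are long on average. -/
theorem star_sum_bound {a b q : Plane} (hab : a ≠ b)
    (hq : 0.691 * dist a b ^ 2 ≤ |across a b q|) (v : Plane) :
    3 * 0.519 * dist a b ≤ dist v a + dist v b + dist v q := by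
  have hd := dist_pos.2 hab
  have hne : dist a b ^ 2 ≠ 0 := by positivity
  have ha := dist_eq_mul_sqrt hab v a
  have hb := dist_eq_mul_sqrt hab v b
  have hq' := dist_eq_mul_sqrt hab v q
  have h := three_distances_bound (x := along a b v / dist a b ^ 2)
    (y := across a b v / dist a b ^ 2) (X := along a b q / dist a b ^ 2)
    (Y := across a b q / dist a b ^ 2)
    (by rw [abs_div, abs_of_pos (show 0 < dist a b ^ 2 by positivity), le_div_iff₀ (by positivity)]
        exact hq)
  rw [show along a b a = 0 by simp [along], show across a b a = 0 by simp [across]] at ha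
  rw [along_self, show across a b b = 0 by unfold across; ring, div_self hne, ← neg_sub 1,
    neg_sq] at hb
  simp only [zero_div, sub_zero] at ha hb
  rw [ha, hb, hq', ← mul_add, ← mul_add, mul_comm]
  exact mul_le_mul_of_nonneg_left h hd.le

/-- The scaled form of `lens_mixture_bound`, where `e` stands for the length of the fan edge at `v`,
of which only the extent along `ab` is used. -/
theorem mixture_bound {a b v w : Plane} (hab : a ≠ b) (hv : along a b v ≤ dist a b ^ 2 / 2)
    (hvb : dist v b ≤ dist a b) (hwa : dist w a ≤ dist a b)
    (hwb : dist w b ≤ dist a b) (hvw : dist v w ≤ dist a b)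
    (hyv : |across a b v| ≤ 0.691 * dist a b ^ 2) (hyw : |across a b w| ≤ 0.691 * dist a b ^ 2)
    {e : ℝ} (he : dist a b ^ 2 / 2 - along a b v ≤ e * dist a b) :
    2 * 0.519 * dist v w ≤ 0.9 * (dist v a + dist v b) + 0.1 * (e + dist v b) := by
  have hd := dist_pos.2 hab
  have hD : 0 < dist a b ^ 2 := by positivity
  have hne : dist a b ^ 2 ≠ 0 := hD.ne'
  have ea : ∀ z, dist z a = dist a b * √((along a b z / dist a b ^ 2) ^ 2 +
      (across a b z / dist a b ^ 2) ^ 2) := by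
    intro z
    have ha := dist_eq_mul_sqrt hab z a
    rw [show along a b a = 0 by simp [along], show across a b a = 0 by simp [across]] at ha
    simpa only [zero_div, sub_zero] using ha
  have eb : ∀ z, dist z b = dist a b * √((1 - along a b z / dist a b ^ 2) ^ 2 +
      (across a b z / dist a b ^ 2) ^ 2) := by
    intro z
    have hb := dist_eq_mul_sqrt hab z b
    rw [along_self, show across a b b = 0 by unfold across; ring, div_self hne, ← neg_sub 1,
      neg_sq] at hb
    simpa only [zero_div, sub_zero] using hb
  have le_one : ∀ {s t : ℝ}, t = dist a b * √s → t ≤ dist a b → s ≤ 1 := by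
    intro s t h1 h2
    rw [h1] at h2
    have : √s ≤ 1 := by
      by_contra hc
      nlinarith [not_le.1 hc]
    exact Real.sqrt_le_one.1 this
  have h := lens_mixture_bound (x := along a b v / dist a b ^ 2) (y := across a b v / dist a b ^ 2)
    (X := along a b w / dist a b ^ 2) (Y := across a b w / dist a b ^ 2)
    (by rw [div_le_iff₀ hD]; linarith) (le_one (eb v) hvb)
    (by rw [abs_div, abs_of_pos hD, div_le_iff₀ hD]; exact hyv)
    (le_one (ea w) hwa) (le_one (eb w) hwb)
    (by rw [abs_div, abs_of_pos hD, div_le_iff₀ hD]; exact hyw)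
    (le_one (dist_eq_mul_sqrt hab v w) hvw)
  have h' := mul_le_mul_of_nonneg_left h hd.le
  have he' : dist a b * (1 / 2 - along a b v / dist a b ^ 2) ≤ e := by
    rw [show dist a b * (1 / 2 - along a b v / dist a b ^ 2) =
      (dist a b ^ 2 / 2 - along a b v) / dist a b by field_simp, div_le_iff₀ hd]
    exact he
  rw [dist_eq_mul_sqrt hab v w, ea v, eb v]
  linarith

/-- Cauchy–Schwarz; the defect in Lagrange's identity is the square of the cross product. -/
theorem along_sub_le_dist_mul (a b v w : Plane) :
    along a b w - along a b v ≤ dist v w * dist a b := by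
  have h : (along a b w - along a b v) ^ 2 ≤ (dist v w * dist a b) ^ 2 := by
    rw [mul_pow, dist_sq_eq, dist_sq_eq]
    unfold along
    nlinarith [sq_nonneg ((b 0 - a 0) * (w 1 - v 1) - (b 1 - a 1) * (w 0 - v 0))]
  exact (abs_le_of_sq_le_sq' h (by positivity)).2

variable {n : ℕ}

/-- The parent of a near point lies beyond the bisector, so the edge has to reach it; for a far
point the left side is not positive. -/
theorem IsFanMap.le_dist_near {P : Fin n → Plane} {a b : Fin n} {f : Fin n → Fin n}
    (hf : IsFanMap P a b f) {v : Fin n} (hva : v ≠ a) :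
    dist (P a) (P b) ^ 2 / 2 - along (P a) (P b) (P v) ≤
      dist (P v) (P (f v)) * dist (P a) (P b) := by
  obtain ⟨S, far, t, hS, hfar, htf, hts, hw⟩ := hf.near
  by_cases h : far v
  · rw [hfar, along_self] at h
    have : 0 ≤ dist (P v) (P (f v)) * dist (P a) (P b) := by positivity
    linarith
  · have := (hfar _).1 ((hw v hva h).far_of htf)
    rw [along_self] at this
    have := along_sub_le_dist_mul (P a) (P b) (P v) (P (f v))
    linarith

/-- A point in the half of `a` counts as far from `b`, so the fan at `b` joins it directly to `b`.
-/
theorem IsFanMap.pointwise_bound {P : Fin n → Plane} {a b : Fin n} {f f' : Fin n → Fin n}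
    (hab : P a ≠ P b) (hf : IsFanMap P a b f) (hf' : IsFanMap P b a f')
    (hd : ∀ u v, dist (P u) (P v) ≤ dist (P a) (P b))
    (hy : ∀ v, |across (P a) (P b) (P v)| ≤ 0.691 * dist (P a) (P b) ^ 2)
    {v : Fin n} (hva : v ≠ a) (hvx : along (P a) (P b) (P v) ≤ dist (P a) (P b) ^ 2 / 2)
    (w : Fin n) :
    2 * 0.519 * dist (P v) (P w) ≤ 0.9 * (dist (P v) (P a) + dist (P v) (P b)) +
      0.1 * (dist (P v) (P (f v)) + dist (P v) (P (f' v))) := by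
  have e : f' v = b := by
    apply hf'.far
    rw [along_self, along_swap, dist_comm (P b)]
    push Not
    linarith
  rw [e]
  exact mixture_bound hab hvx (hd _ _) (hd _ _) (hd _ _) (hd _ _) (hy _) (hy _)
    (hf.le_dist_near hva)

/-- The best one among all stars and the two fans at a diametral pair is a `0.519`-approximation
of the longest spanning tree. -/
theorem approximation_of_stars_and_fans {P : Fin n → Plane} (hP : Function.Injective P)
    {a b : Fin n} (hab : a ≠ b) (hd : ∀ u v, dist (P u) (P v) ≤ dist (P a) (P b))
    {f f' : Fin n → Fin n} (hf : IsFanMap P a b f) (hf' : IsFanMap P b a f') {M : ℝ}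
    (hstar : ∀ c, parentLength P (fun _ => c) ≤ M) (hM : parentLength P f ≤ M)
    (hM' : parentLength P f' ≤ M) {T : SimpleGraph (Fin n)} (hT : T.IsTree) :
    0.519 * totalLength P T ≤ M := by
  have hPab : P a ≠ P b := fun e => hab (hP e)
  have hd0 := dist_pos.2 hPab
  by_cases hq : ∃ q, 0.691 * dist (P a) (P b) ^ 2 ≤ |across (P a) (P b) (P q)|
  · obtain ⟨q, hq⟩ := hq
    have h1 := totalLength_le_sum_erase hT a (fun _ => dist (P a) (P b)) hd
    have h2 : ∑ p ∈ Finset.univ.erase a, dist (P a) (P b) ≤ ∑ p : Fin n, dist (P a) (P b) :=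
      Finset.sum_le_sum_of_subset_of_nonneg (Finset.subset_univ _) fun _ _ _ => hd0.le
    have h3 : ∑ p : Fin n, 3 * 0.519 * dist (P a) (P b) ≤
        ∑ p, (dist (P p) (P a) + dist (P p) (P b) + dist (P p) (P q)) :=
      Finset.sum_le_sum fun p _ => star_sum_bound hPab hq (P p)
    rw [Finset.sum_add_distrib, Finset.sum_add_distrib, ← Finset.mul_sum] at h3
    have ha := hstar a
    have hb := hstar b
    have hq := hstar q
    unfold parentLength at ha hb hq
    linarith
  · push Not at hq
    have hy : ∀ v, |across (P a) (P b) (P v)| ≤ 0.691 * dist (P a) (P b) ^ 2 :=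
      fun v => (hq v).le
    set G : Fin n → ℝ := fun v => 0.9 * (dist (P v) (P a) + dist (P v) (P b)) +
      0.1 * (dist (P v) (P (f v)) + dist (P v) (P (f' v))) with hG
    have hGsum : ∑ v, G v ≤ 2 * M := by
      have ha := hstar a
      have hb := hstar b
      unfold parentLength at ha hb hM hM'
      simp only [hG]
      rw [Finset.sum_add_distrib, ← Finset.mul_sum, ← Finset.mul_sum, Finset.sum_add_distrib,
        Finset.sum_add_distrib]
      linarith
    -- The points in the half of `b` are handled by exchanging `a` and `b`, which exchanges the two
    -- fans.
    have hGpt : ∀ v w, v ≠ a → v ≠ b → 2 * 0.519 * dist (P v) (P w) ≤ G v := by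
      intro v w hva hvb
      rcases le_total (along (P a) (P b) (P v)) (dist (P a) (P b) ^ 2 / 2) with h | h
      · exact hf.pointwise_bound hPab hf' hd hy hva h w
      · have hd' : ∀ u v, dist (P u) (P v) ≤ dist (P b) (P a) := by
          intro u v; rw [dist_comm (P b)]; exact hd u v
        have := hf'.pointwise_bound hPab.symm hf hd'
          (by intro v; rw [across_swap, abs_neg, dist_comm (P b)]; exact hy v) hvb
          (by rw [along_swap, dist_comm (P b)]; linarith) w
        simp only [hG]
        linarith
    have hba : f a = a := hf.root
    have hbb : f b = a := hf.far b (by rw [along_self]; push Not; nlinarith)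
    have hb'b : f' b = b := hf'.root
    have hb'a : f' a = b := hf'.far a (by
      rw [along_self, dist_comm]; push Not; nlinarith)
    have hGa : G a = dist (P a) (P b) := by
      simp only [hG, hba, hb'a, dist_self]; ring
    have hGb : G b = dist (P a) (P b) := by
      simp only [hG, hbb, hb'b, dist_self, dist_comm (P b)]; ring
    have hbmem : b ∈ (Finset.univ.erase a : Finset (Fin n)) := by simp [hab.symm]
    -- At `a` and `b` the mixture is only `dist (P a) (P b)`, because each is the root of one star
    -- and one fan. These two vertices therefore get the trivial bound.
    set φ : Fin n → ℝ := fun v => if v = a ∨ v = b then dist (P a) (P b) else G v / (2 * 0.519)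
      with hφ
    have hbd : ∀ p q, dist (P p) (P q) ≤ φ p := by
      intro p q
      simp only [hφ]
      split_ifs with h
      · exact hd p q
      · push Not at h
        rw [le_div_iff₀ (by norm_num)]
        have := hGpt p q h.1 h.2
        linarith
    have h1 := totalLength_le_sum_erase hT a φ hbd
    rw [← Finset.add_sum_erase _ _ hbmem] at h1
    -- Leaving out the root `a` repairs the deficit: `a` and `b` together contribute twice the
    -- diameter to the mixture, and only one diameter times `2 * 0.519` is needed.
    rw [← Finset.add_sum_erase _ _ (Finset.mem_univ a), ← Finset.add_sum_erase _ _ hbmem, hGa,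
      hGb] at hGsum
    have h2 : ∑ v ∈ (Finset.univ.erase a).erase b, φ v =
        (∑ v ∈ (Finset.univ.erase a).erase b, G v) / (2 * 0.519) := by
      rw [Finset.sum_div]
      refine Finset.sum_congr rfl fun v hv => ?_
      have h1 := Finset.ne_of_mem_erase hv
      have h2 := Finset.ne_of_mem_erase (Finset.mem_of_mem_erase hv)
      simp only [hφ, h1, h2, or_self, if_false]
    have h3 : φ b = dist (P a) (P b) := by simp [hφ]
    rw [h2, h3] at h1
    have h4 := mul_le_mul_of_nonneg_left h1 (show (0 : ℝ) ≤ 2 * 0.519 by norm_num)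
    rw [mul_add, mul_div_cancel₀ _ (by norm_num)] at h4
    linarith

end Approximation

/-! ### Program logic: frames, running times and counting loops -/

namespace RealRAM

/-- The program `p` may write into the integer array `A`. -/
def Prog.writesInt : Prog → ℕ → Bool
  | .skip, _ => false
  | .setInt B _ _, A => A == B
  | .setReal _ _ _, _ => false
  | .seq p q, A => p.writesInt A || q.writesInt A
  | .cond _ p q, A => p.writesInt A || q.writesInt A
  | .loop _ p, A => p.writesInt A

/-- The program `p` may write into the real array `A`. -/
def Prog.writesReal : Prog → ℕ → Bool
  | .skip, _ => false
  | .setInt _ _ _, _ => false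
  | .setReal B _ _, A => A == B
  | .seq p q, A => p.writesReal A || q.writesReal A
  | .cond _ p q, A => p.writesReal A || q.writesReal A
  | .loop _ p, A => p.writesReal A

namespace Store

theorem setInt_int_self (s : Store) (A i v : ℕ) :
    (s.setInt A i v).int A = Function.update (s.int A) i v := by simp [setInt]

theorem setInt_int_of_ne (s : Store) {A B : ℕ} (h : B ≠ A) (i v : ℕ) :
    (s.setInt A i v).int B = s.int B := by simp [setInt, h]

theorem setInt_real (s : Store) (A i v : ℕ) : (s.setInt A i v).real = s.real := rfl

theorem setReal_real_self (s : Store) (A i : ℕ) (v : ℝ) :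
    (s.setReal A i v).real A = Function.update (s.real A) i v := by simp [setReal]

theorem setReal_real_of_ne (s : Store) {A B : ℕ} (h : B ≠ A) (i : ℕ) (v : ℝ) :
    (s.setReal A i v).real B = s.real B := by simp [setReal, h]

theorem setReal_int (s : Store) (A i : ℕ) (v : ℝ) : (s.setReal A i v).int = s.int := rfl

end Store

/-- Subroutines communicate through few named arrays, so preservation of the others reduces to a
syntactic check that evaluates by `rfl`. -/
theorem Exec.int_frame {p : Prog} {s s' : Store} {t A : ℕ} (h : Exec p s t s')
    (hA : p.writesInt A = false) : s'.int A = s.int A := by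
  induction h with
  | skip => rfl
  | setInt s B i e =>
    exact Store.setInt_int_of_ne _ (by simpa [Prog.writesInt] using hA) _ _
  | setReal => rfl
  | seq _ _ ih ih' =>
    simp only [Prog.writesInt, Bool.or_eq_false_iff] at hA
    rw [ih' hA.2, ih hA.1]
  | condTrue _ _ ih =>
    simp only [Prog.writesInt, Bool.or_eq_false_iff] at hA
    exact ih hA.1
  | condFalse _ _ ih =>
    simp only [Prog.writesInt, Bool.or_eq_false_iff] at hA
    exact ih hA.2
  | loopTrue _ _ _ ih ih' => rw [ih' hA, ih hA]
  | loopFalse => rfl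

theorem Exec.real_frame {p : Prog} {s s' : Store} {t A : ℕ} (h : Exec p s t s')
    (hA : p.writesReal A = false) : s'.real A = s.real A := by
  induction h with
  | skip => rfl
  | setInt => rfl
  | setReal s B i e =>
    exact Store.setReal_real_of_ne _ (by simpa [Prog.writesReal] using hA) _ _
  | seq _ _ ih ih' =>
    simp only [Prog.writesReal, Bool.or_eq_false_iff] at hA
    rw [ih' hA.2, ih hA.1]
  | condTrue _ _ ih =>
    simp only [Prog.writesReal, Bool.or_eq_false_iff] at hA
    exact ih hA.1
  | condFalse _ _ ih =>
    simp only [Prog.writesReal, Bool.or_eq_false_iff] at hA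
    exact ih hA.2
  | loopTrue _ _ _ ih ih' => rw [ih' hA, ih hA]
  | loopFalse => rfl

/-- Started in memory `s`, the program `p` halts after at most `B` steps in memory `s'`. -/
def Runs (p : Prog) (s : Store) (B : ℕ) (s' : Store) : Prop :=
  ∃ t, Exec p s t s' ∧ t ≤ B

namespace Runs

variable {p q : Prog} {s s' s'' : Store} {B B' : ℕ}

theorem int_frame (h : Runs p s B s') {A : ℕ} (hA : p.writesInt A = false) :
    s'.int A = s.int A := by
  obtain ⟨t, h, -⟩ := h
  exact h.int_frame hA

theorem real_frame (h : Runs p s B s') {A : ℕ} (hA : p.writesReal A = false) :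
    s'.real A = s.real A := by
  obtain ⟨t, h, -⟩ := h
  exact h.real_frame hA

theorem mono (h : Runs p s B s') (hB : B ≤ B') : Runs p s B' s' := by
  obtain ⟨t, h, ht⟩ := h
  exact ⟨t, h, ht.trans hB⟩

theorem skip (s : Store) : Runs .skip s 1 s := ⟨1, .skip s, le_rfl⟩

theorem setInt (s : Store) (A : ℕ) (i e : IntExpr) :
    Runs (.setInt A i e) s (i.cost + e.cost + 1) (s.setInt A (i.val s) (e.val s)) :=
  ⟨_, .setInt s A i e, le_rfl⟩

theorem setReal (s : Store) (A : ℕ) (i : IntExpr) (e : RealExpr) :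
    Runs (.setReal A i e) s (i.cost + e.cost + 1) (s.setReal A (i.val s) (e.val s)) :=
  ⟨_, .setReal s A i e, le_rfl⟩

theorem seq (h : Runs p s B s') (h' : Runs q s' B' s'') : Runs (.seq p q) s (B + B') s'' := by
  obtain ⟨t, h, ht⟩ := h
  obtain ⟨t', h', ht'⟩ := h'
  exact ⟨_, .seq h h', Nat.add_le_add ht ht'⟩

theorem condTrue {b : Test} (hb : b.Holds s) (h : Runs p s B s') :
    Runs (.cond b p q) s (b.cost + B + 1) s' := by
  obtain ⟨t, h, ht⟩ := h
  exact ⟨_, .condTrue hb h, by omega⟩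

theorem condFalse {b : Test} (hb : ¬ b.Holds s) (h : Runs q s B s') :
    Runs (.cond b p q) s (b.cost + B + 1) s' := by
  obtain ⟨t, h, ht⟩ := h
  exact ⟨_, .condFalse hb h, by omega⟩

end Runs

/-- The integer variable that is stored in entry `0` of the integer array `A`. -/
def intVar (A : ℕ) : IntExpr := .get A (.const 0)

/-- The real variable that is stored in entry `0` of the real array `A`. -/
def realVar (A : ℕ) : RealExpr := .get A (.const 0)

/-- Execute `p` for the values `0, …, n - 1` of the variable `C`, where `n` is the number in
entry `0` of the integer array `0`. -/
def forLoop (C : ℕ) (p : Prog) : Prog :=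
  .seq (.setInt C (.const 0) (.const 0))
    (.loop (.intLt (intVar C) (intVar 0))
      (.seq p (.setInt C (.const 0) (.add (intVar C) (.const 1)))))

/-- The invariant rule, by induction on the number of remaining rounds. The frame facts handed to
`step` let invariants mention only what the body changes. Per round the guard and branching cost 6
and the increment 6; initialisation and the last guard cost 9. -/
theorem forLoop_spec {C : ℕ} {p : Prog} {n B : ℕ} {s₀ : Store} (I : ℕ → Store → Prop)
    (hC : C ≠ 0) (hp0 : p.writesInt 0 = false) (hpC : p.writesInt C = false)
    (hn : s₀.int 0 0 = n) (h0 : I 0 (s₀.setInt C 0 0))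
    (step : ∀ k < n, ∀ s : Store,
      (∀ A, p.writesInt A = false → A ≠ C → s.int A = s₀.int A) →
      (∀ A, p.writesReal A = false → s.real A = s₀.real A) →
      s.int C 0 = k → I k s →
      ∃ s', Runs p s B s' ∧ I (k + 1) (s'.setInt C 0 (k + 1))) :
    ∃ s', Runs (forLoop C p) s₀ ((B + 12) * n + 9) s' ∧ I n s' := by
  have key : ∀ m k, k + m = n → ∀ s : Store,
      (∀ A, p.writesInt A = false → A ≠ C → s.int A = s₀.int A) →
      (∀ A, p.writesReal A = false → s.real A = s₀.real A) →
      s.int C 0 = k → I k s →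
      ∃ s', Runs (.loop (.intLt (intVar C) (intVar 0))
        (.seq p (.setInt C (.const 0) (.add (intVar C) (.const 1))))) s ((B + 12) * m + 6) s' ∧
        I n s' := by
    intro m
    induction m with
    | zero =>
      intro k hk s hi hr hs hI
      obtain rfl : k = n := by omega
      refine ⟨s, ⟨_, .loopFalse ?_, ?_⟩, hI⟩
      · simp only [Test.Holds, IntExpr.val, intVar, hs, hi 0 hp0 hC.symm, hn]
        exact lt_irrefl _
      · simp [Test.cost, IntExpr.cost, intVar]
    | succ m ih =>
      intro k hk s hi hr hs hI
      obtain ⟨s', ⟨t, he, ht⟩, hI'⟩ := step k (by omega) s hi hr hs hI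
      have hC' : s'.int C 0 = k := by rw [he.int_frame hpC, hs]
      obtain ⟨s'', ⟨t', he', ht'⟩, hI''⟩ := ih (k + 1) (by omega) (s'.setInt C 0 (k + 1))
        (fun A hA hAC => by
          rw [Store.setInt_int_of_ne _ hAC, he.int_frame hA, hi A hA hAC])
        (fun A hA => by rw [Store.setInt_real, he.real_frame hA, hr A hA])
        (by simp [Store.setInt_int_self]) hI'
      refine ⟨s'', ⟨_, .loopTrue (t' := t') ?_ (.seq he (.setInt s' C (.const 0)
        (.add (intVar C) (.const 1)))) ?_, ?_⟩, hI''⟩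

      · simp only [Test.Holds, IntExpr.val, intVar, hs, hi 0 hp0 hC.symm, hn]
        omega
      · simp only [IntExpr.val, intVar, hC']
        exact he'
      · simp only [Test.cost, IntExpr.cost, intVar]
        rw [Nat.mul_succ]
        omega
  obtain ⟨s', ⟨t, he, ht⟩, hI⟩ := key n 0 (by omega) (s₀.setInt C 0 0)
    (fun A _ hAC => Store.setInt_int_of_ne _ hAC _ _) (fun A _ => rfl)
    (by simp [Store.setInt_int_self]) h0
  refine ⟨s', ⟨_, .seq (.setInt s₀ C (.const 0) (.const 0)) he, ?_⟩, hI⟩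
  simp only [IntExpr.cost]
  omega

/-- The memory `s` contains the input `P`. -/
def HasInput {n : ℕ} (P : Fin n → Plane) (s : Store) : Prop :=
  s.int 0 0 = n ∧ ∀ i : Fin n, s.real 0 i = P i 0 ∧ s.real 1 i = P i 1

theorem hasInput_inputStore {n : ℕ} (P : Fin n → Plane) : HasInput P (inputStore P) :=
  ⟨by simp [inputStore], fun i => by simp [inputStore]⟩

theorem HasInput.of_eq {n : ℕ} {P : Fin n → Plane} {s s' : Store} (h : HasInput P s)
    (h0 : s'.int 0 = s.int 0) (h1 : s'.real 0 = s.real 0) (h2 : s'.real 1 = s.real 1) :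
    HasInput P s' := by
  unfold HasInput
  rw [h0, h1, h2]
  exact h

end RealRAM

/-! ### Subroutines: length, output, stars and diameter -/

namespace RealRAM

variable {n : ℕ}

@[simp] theorem intVar_val (s : Store) (A : ℕ) : (intVar A).val s = s.int A 0 := rfl

@[simp] theorem realVar_val (s : Store) (A : ℕ) : (realVar A).val s = s.real A 0 := rfl

@[simp] theorem intVar_cost (A : ℕ) : (intVar A).cost = 2 := rfl

@[simp] theorem realVar_cost (A : ℕ) : (realVar A).cost = 2 := rfl

/-- The square of the distance of the points with the indices `i` and `j`. -/
def sqDistExpr (i j : IntExpr) : RealExpr :=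
  .add (.mul (.sub (.get 0 i) (.get 0 j)) (.sub (.get 0 i) (.get 0 j)))
    (.mul (.sub (.get 1 i) (.get 1 j)) (.sub (.get 1 i) (.get 1 j)))

theorem sqDistExpr_val {P : Fin n → Plane} {s : Store} (h : HasInput P s) {e f : IntExpr}
    {i j : Fin n} (he : e.val s = i) (hf : f.val s = j) :
    (sqDistExpr e f).val s = dist (P i) (P j) ^ 2 := by
  simp only [sqDistExpr, RealExpr.val, he, hf, (h.2 _).1, (h.2 _).2, dist_sq_eq]
  ring

/-- Compute the length of the tree with the parent map in the integer array `3`. -/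
def lengthProg : Prog :=
  .seq (.setReal 3 (.const 0) (.const 0))
    (forLoop 5 (.setReal 3 (.const 0)
      (.add (realVar 3) (.sqrt (sqDistExpr (intVar 5) (.get 3 (intVar 5)))))))

theorem lengthProg_spec {P : Fin n → Plane} {s : Store} (h : HasInput P s) {f : Fin n → Fin n}
    (hf : ∀ i : Fin n, s.int 3 i = f i) :
    ∃ s', Runs lengthProg s (100 * n + 20) s' ∧ s'.real 3 0 = parentLength P f := by
  -- The summands are extended by zero so that the partial sums over `Finset.range k` can serve as
  -- the invariant.
  set g : ℕ → ℝ := fun i => if hi : i < n then dist (P ⟨i, hi⟩) (P (f ⟨i, hi⟩)) else 0 with hg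
  have hin : HasInput P (s.setReal 3 0 0) := h
  obtain ⟨s', hr, hI⟩ := forLoop_spec (C := 5) (n := n) (B := 80) (s₀ := s.setReal 3 0 0)
    (p := .setReal 3 (.const 0)
      (.add (realVar 3) (.sqrt (sqDistExpr (intVar 5) (.get 3 (intVar 5))))))
    (fun k s => s.real 3 0 = ∑ i ∈ Finset.range k, g i) (by decide) rfl rfl hin.1
    (by simp [Store.setInt_real, Store.setReal_real_self])
    (by
      intro k hk s₁ hi hr hc hI
      have hin₁ : HasInput P s₁ := hin.of_eq (hi 0 rfl (by decide)) (hr 0 rfl) (hr 1 rfl)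
      have h3 : s₁.int 3 = s.int 3 := hi 3 rfl (by decide)
      refine ⟨_, (Runs.setReal _ _ _ _).mono (by decide), ?_⟩
      have hv := sqDistExpr_val hin₁ (e := intVar 5) (f := .get 3 (intVar 5)) (i := ⟨k, hk⟩)
        (j := f ⟨k, hk⟩) hc (by simp only [IntExpr.val, intVar_val, hc, h3]; exact hf ⟨k, hk⟩)
      simp only [Store.setInt_real, Store.setReal_real_self, IntExpr.val, RealExpr.val,
        Function.update_self, realVar_val, hI, hv, Real.sqrt_sq dist_nonneg, Finset.sum_range_succ]
      simp [hg, hk])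
  refine ⟨s', ((Runs.setReal s 3 (.const 0) (.const 0)).seq (by
    simpa [IntExpr.val, RealExpr.val] using hr)).mono ?_, ?_⟩
  · simp only [IntExpr.cost, RealExpr.cost]; omega
  · rw [hI, ← Fin.sum_univ_eq_sum_range]
    simp [hg, parentLength]

/-- Write the edges of the tree with the parent map in the integer array `3` and the root in the
integer variable `9` into the output arrays. -/
def outputProg : Prog :=
  .seq (forLoop 5 (.seq (.setInt 1 (intVar 5) (intVar 5))
      (.setInt 2 (intVar 5) (.get 3 (intVar 5)))))
    (.seq (.setInt 1 (intVar 9) (.sub (intVar 0) (.const 1)))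
      (.setInt 2 (intVar 9) (.get 3 (.sub (intVar 0) (.const 1)))))

/-- Only the slots below `n - 1` are read, while the `n - 1` edges belong to the vertices other than
`r`. The free slot `r` therefore takes the edge of the vertex `n - 1`; if `r` is that vertex, its
slot is not read. -/
theorem outputGraph_eq_parentGraph {s : Store} {f : Fin n → Fin n} {r : Fin n} (hr : f r = r)
    (h : ∀ k : Fin n, k ≠ r → s.int 1 k = k ∧ s.int 2 k = f k)
    (h1 : s.int 1 r = n - 1) (h2 : ∀ l : Fin n, (l : ℕ) = n - 1 → s.int 2 r = f l) :
    outputGraph n s = parentGraph f := by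
  have key : ∀ u v : Fin n, u ≠ v →
      ((∃ k < n - 1, s.int 1 k = u ∧ s.int 2 k = v) ↔ f u = v) := by
    intro u v huv
    constructor
    · rintro ⟨k, hk, e1, e2⟩
      have hkn : k < n := by omega
      by_cases hkr : (⟨k, hkn⟩ : Fin n) = r
      · subst hkr
        have := h2 u (by rw [← e1]; exact h1)
        exact Fin.ext (by rw [← e2]; exact this.symm)
      · obtain ⟨e3, e4⟩ := h ⟨k, hkn⟩ hkr
        have : u = ⟨k, hkn⟩ := Fin.ext (by rw [← e1]; exact e3)
        rw [this]
        exact Fin.ext (by rw [← e2]; exact e4.symm)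
    · intro e
      have hur : u ≠ r := by
        rintro rfl
        exact huv (by rw [← e, hr])
      have hu := u.2
      have hrn := r.2
      have hne : (u : ℕ) ≠ r := fun e => hur (Fin.ext e)
      by_cases hun : (u : ℕ) = n - 1
      · exact ⟨r, by omega, by rw [h1, hun], by rw [h2 u hun, e]⟩
      · exact ⟨u, by omega, (h u hur).1, by rw [(h u hur).2, e]⟩
  ext u v
  rw [outputGraph, parentGraph, SimpleGraph.fromRel_adj, SimpleGraph.fromRel_adj]
  refine and_congr_right fun huv => or_congr (key u v huv) (key v u huv.symm)

theorem outputProg_spec {s : Store} (hn : s.int 0 0 = n) {f : Fin n → Fin n} {r : Fin n}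
    (hr : f r = r) (hf : ∀ i : Fin n, s.int 3 i = f i) (h9 : s.int 9 0 = r) :
    ∃ s', Runs outputProg s (40 * n + 40) s' ∧ outputGraph n s' = parentGraph f := by
  obtain ⟨s', hs', hI⟩ := forLoop_spec (C := 5) (n := n) (B := 20) (s₀ := s)
    (p := .seq (.setInt 1 (intVar 5) (intVar 5)) (.setInt 2 (intVar 5) (.get 3 (intVar 5))))
    (fun k s => ∀ i : Fin n, (i : ℕ) < k → s.int 1 i = i ∧ s.int 2 i = f i)
    (by decide) rfl rfl hn (fun i hi => absurd hi (Nat.not_lt_zero _))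
    (by
      intro k hk s₁ hi hr hc hI
      have h3 : s₁.int 3 = s.int 3 := hi 3 rfl (by decide)
      refine ⟨_, ((Runs.setInt _ _ _ _).seq (Runs.setInt _ _ _ _)).mono (by decide), ?_⟩
      intro i hik
      by_cases h : (i : ℕ) = k
      · obtain rfl : i = ⟨k, hk⟩ := Fin.ext h
        have := hf ⟨k, hk⟩
        simpa [IntExpr.val, Store.setInt, hc, h3] using this
      · simpa [IntExpr.val, Store.setInt, hc, h] using hI i (by omega))
  have hi : ∀ A, A ≠ 1 → A ≠ 2 → A ≠ 5 → s'.int A = s.int A := by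
    intro A h1 h2 h5
    exact hs'.int_frame (by simp [Prog.writesInt, forLoop, h1, h2, h5])
  have e0 : s'.int 0 = s.int 0 := hi 0 (by decide) (by decide) (by decide)
  have e3 : s'.int 3 = s.int 3 := hi 3 (by decide) (by decide) (by decide)
  have e9 : s'.int 9 = s.int 9 := hi 9 (by decide) (by decide) (by decide)
  refine ⟨_, (hs'.seq ((Runs.setInt _ _ _ _).seq (Runs.setInt _ _ _ _))).mono ?_, ?_⟩
  · simp only [IntExpr.cost, intVar_cost]; omega
  · apply outputGraph_eq_parentGraph hr
    · intro k hk
      have hkr : (k : ℕ) ≠ r := fun e => hk (Fin.ext e)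
      simpa [IntExpr.val, Store.setInt, Function.update_apply, e9, h9, hkr] using hI k k.2
    · simp [IntExpr.val, Store.setInt, e9, h9, e0, hn]
    · intro l hl
      simp [IntExpr.val, Store.setInt, e9, h9, e0, hn, e3, ← hl, hf]

/-- If the real variable `2` is not negative, then it is the length of the plane tree in the output
arrays. -/
def HasTree (P : Fin n → Plane) (s : Store) : Prop :=
  s.real 2 0 < 0 ∨ ∃ f r, IsPlaneParentMap P f r ∧ s.real 2 0 = parentLength P f ∧
    outputGraph n s = parentGraph f

theorem HasTree.of_eq {P : Fin n → Plane} {s s' : Store} (h : HasTree P s)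
    (h1 : s'.int 1 = s.int 1) (h2 : s'.int 2 = s.int 2) (h3 : s'.real 2 = s.real 2) :
    HasTree P s' := by
  unfold HasTree outputGraph
  rw [h1, h2, h3]
  exact h

/-- Replace the tree in the output arrays by the tree with the parent map in the integer array `3`
and the root in the integer variable `9` if the latter is longer. -/
def improveProg : Prog :=
  .seq lengthProg (.cond (.realLt (realVar 2) (realVar 3))
    (.seq (.setReal 2 (.const 0) (realVar 3)) outputProg) .skip)

theorem improveProg_spec {P : Fin n → Plane} {s : Store} (h : HasInput P s) (ht : HasTree P s)
    {f : Fin n → Fin n} {r : Fin n} (hT : IsPlaneParentMap P f r)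
    (hf : ∀ i : Fin n, s.int 3 i = f i) (h9 : s.int 9 0 = r) :
    ∃ s', Runs improveProg s (140 * n + 80) s' ∧ HasTree P s' ∧ s.real 2 0 ≤ s'.real 2 0 ∧
      parentLength P f ≤ s'.real 2 0 := by
  obtain ⟨s₁, h₁, e₁⟩ := lengthProg_spec h hf
  have hi : ∀ A, A ≠ 5 → s₁.int A = s.int A := by
    intro A h5
    exact h₁.int_frame (by simp [Prog.writesInt, lengthProg, forLoop, h5])
  have hr2 : s₁.real 2 = s.real 2 := h₁.real_frame rfl
  by_cases hc : s₁.real 2 0 < s₁.real 3 0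
  · obtain ⟨s₂, h₂, e₂⟩ := outputProg_spec (s := s₁.setReal 2 0 (s₁.real 3 0)) (f := f) (r := r)
      (by rw [Store.setReal_int, hi 0 (by decide)]; exact h.1) hT.root
      (by rw [Store.setReal_int, hi 3 (by decide)]; exact hf)
      (by rw [Store.setReal_int, hi 9 (by decide)]; exact h9)
    have e2 : s₂.real 2 0 = parentLength P f := by
      rw [h₂.real_frame rfl, ← e₁]
      simp [Store.setReal_real_self]
    refine ⟨s₂, (h₁.seq (Runs.condTrue
      (show Test.Holds s₁ (.realLt (realVar 2) (realVar 3)) from hc) ((Runs.setReal s₁ 2 (.const 0) (realVar 3)).seq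
      h₂))).mono ?_, Or.inr ⟨f, r, hT, e2, e₂⟩, ?_, e2.ge⟩
    · simp only [Test.cost, IntExpr.cost, realVar_cost]; omega
    · rw [e2, ← e₁, ← hr2]; exact hc.le
  · refine ⟨s₁, (h₁.seq (Runs.condFalse
      (show ¬ Test.Holds s₁ (.realLt (realVar 2) (realVar 3)) from hc) (Runs.skip s₁))).mono ?_,
      ht.of_eq (hi 1 (by decide)) (hi 2 (by decide)) hr2, by rw [hr2], ?_⟩
    · simp only [Test.cost, realVar_cost]; omega
    · rw [← e₁]; exact not_lt.1 hc

/-- Try all stars. -/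
def starsProg : Prog :=
  forLoop 6 (.seq (.seq (forLoop 5 (.setInt 3 (intVar 5) (intVar 6)))
    (.setInt 9 (.const 0) (intVar 6))) improveProg)

theorem starsProg_spec {P : Fin n → Plane} {s : Store} (h : HasInput P s) (ht : HasTree P s) :
    ∃ s', Runs starsProg s ((160 * n + 120) * n + 9) s' ∧ HasTree P s' ∧
      ∀ c, parentLength P (fun _ => c) ≤ s'.real 2 0 := by
  obtain ⟨s', hs', hI⟩ := forLoop_spec (C := 6) (n := n) (B := 160 * n + 108) (s₀ := s)
    (p := .seq (.seq (forLoop 5 (.setInt 3 (intVar 5) (intVar 6)))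
      (.setInt 9 (.const 0) (intVar 6))) improveProg)
    (fun k s => HasTree P s ∧ ∀ c : Fin n, (c : ℕ) < k →
      parentLength P (fun _ => c) ≤ s.real 2 0)
    (by decide) rfl rfl h.1 ⟨ht.of_eq rfl rfl rfl, fun c hc => absurd hc (Nat.not_lt_zero _)⟩
    (by
      intro k hk s₁ hi hr hc hI
      have hin₁ : HasInput P s₁ := h.of_eq (hi 0 rfl (by decide)) (hr 0 rfl) (hr 1 rfl)
      obtain ⟨s₂, h₂, e₂⟩ := forLoop_spec (C := 5) (n := n) (B := 6) (s₀ := s₁)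
        (p := .setInt 3 (intVar 5) (intVar 6))
        (fun l s => ∀ i : Fin n, (i : ℕ) < l → s.int 3 i = k)
        (by decide) rfl rfl hin₁.1 (fun i hi => absurd hi (Nat.not_lt_zero _))
        (by
          intro l hl s₂ hi' hr' hc' hI'
          refine ⟨_, (Runs.setInt _ _ _ _).mono (by decide), ?_⟩
          intro i hil
          have h6 : s₂.int 6 0 = k := by rw [hi' 6 rfl (by decide)]; exact hc
          by_cases h : (i : ℕ) = l
          · simp [Store.setInt, hc', h6, h]
          · simpa [Store.setInt, hc', h6, h] using hI' i (by omega))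
      have h6 : s₂.int 6 0 = k := by rw [h₂.int_frame rfl]; exact hc
      have h₃ := h₂.seq (Runs.setInt s₂ 9 (.const 0) (intVar 6))
      obtain ⟨s₄, h₄, t₄, l₄, m₄⟩ := improveProg_spec (P := P) (f := fun _ => ⟨k, hk⟩)
        (r := ⟨k, hk⟩) (hin₁.of_eq (h₃.int_frame rfl) (h₃.real_frame rfl) (h₃.real_frame rfl))
        (hI.1.of_eq (h₃.int_frame rfl) (h₃.int_frame rfl) (h₃.real_frame rfl))
        (star_isPlaneParentMap P ⟨k, hk⟩)
        (fun i => by rw [Store.setInt_int_of_ne _ (by decide)]; exact e₂ i i.2)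
        (by simp [Store.setInt_int_self, IntExpr.val, h6])
      refine ⟨s₄, (h₃.seq h₄).mono ?_, t₄.of_eq ?_ ?_ rfl, fun c hc => ?_⟩
      · simp only [IntExpr.cost, intVar_cost]; omega
      · exact Store.setInt_int_of_ne _ (by decide) _ _
      · exact Store.setInt_int_of_ne _ (by decide) _ _
      · rw [Store.setInt_real]
        rcases Nat.lt_succ_iff_lt_or_eq.1 hc with hck | hck
        · refine (hI.2 c hck).trans (le_trans (le_of_eq ?_) l₄)
          rw [h₃.real_frame rfl]
        · obtain rfl : c = ⟨k, hk⟩ := Fin.ext hck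
          exact m₄)
  exact ⟨s', hs'.mono (by ring_nf; omega), hI.1, fun c => hI.2 c c.2⟩

/-- Find a pair of points of maximum distance. -/
def diameterProg : Prog :=
  .seq (.seq (.setInt 7 (.const 0) (.const 0)) (.setInt 8 (.const 0) (.const 0)))
    (forLoop 5 (forLoop 6 (.cond
      (.realLt (sqDistExpr (intVar 7) (intVar 8)) (sqDistExpr (intVar 5) (intVar 6)))
      (.seq (.setInt 7 (.const 0) (intVar 5)) (.setInt 8 (.const 0) (intVar 6))) .skip)))

theorem diameterProg_spec (hn : 0 < n) {P : Fin n → Plane} {s : Store} (h : HasInput P s) :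
    ∃ s', Runs diameterProg s ((150 * n + 30) * n + 20) s' ∧ ∃ a b : Fin n,
      s'.int 7 0 = a ∧ s'.int 8 0 = b ∧ ∀ u v, dist (P u) (P v) ≤ dist (P a) (P b) := by
  have h₀ := (Runs.setInt s 7 (.const 0) (.const 0)).seq
    (Runs.setInt (s.setInt 7 0 0) 8 (.const 0) (.const 0))
  obtain ⟨s', hs', hI⟩ := forLoop_spec (C := 5) (n := n) (B := 140 * n + 9)
    (s₀ := (s.setInt 7 0 0).setInt 8 0 0)
    (p := forLoop 6 (.cond
      (.realLt (sqDistExpr (intVar 7) (intVar 8)) (sqDistExpr (intVar 5) (intVar 6)))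
      (.seq (.setInt 7 (.const 0) (intVar 5)) (.setInt 8 (.const 0) (intVar 6))) .skip))
    (fun k s => ∃ a b : Fin n, s.int 7 0 = a ∧ s.int 8 0 = b ∧
      ∀ u v : Fin n, (u : ℕ) < k → dist (P u) (P v) ≤ dist (P a) (P b))
    (by decide) rfl rfl h.1
    ⟨⟨0, hn⟩, ⟨0, hn⟩, by simp [Store.setInt], by simp [Store.setInt],
      fun u v hu => absurd hu (Nat.not_lt_zero _)⟩
    (by
      intro k hk s₁ hi hr hc hI
      have hin₁ : HasInput P s₁ := h.of_eq (hi 0 rfl (by decide)) (hr 0 rfl) (hr 1 rfl)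
      obtain ⟨s₂, h₂, e₂⟩ := forLoop_spec (C := 6) (n := n) (B := 128) (s₀ := s₁)
        (p := .cond
          (.realLt (sqDistExpr (intVar 7) (intVar 8)) (sqDistExpr (intVar 5) (intVar 6)))
          (.seq (.setInt 7 (.const 0) (intVar 5)) (.setInt 8 (.const 0) (intVar 6))) .skip)
        -- The pairs already examined form an initial segment of the lexicographic order.
        (fun l s => ∃ a b : Fin n, s.int 7 0 = a ∧ s.int 8 0 = b ∧
          ∀ u v : Fin n, (u : ℕ) < k ∨ (u : ℕ) = k ∧ (v : ℕ) < l →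
            dist (P u) (P v) ≤ dist (P a) (P b))
        (by decide) rfl rfl hin₁.1
        (by
          obtain ⟨a, b, ha, hb, hab⟩ := hI
          refine ⟨a, b, by simpa [Store.setInt] using ha, by simpa [Store.setInt] using hb,
            fun u v huv => hab u v ?_⟩
          omega)
        (by
          intro l hl s₂ hi' hr' hc' hI'
          obtain ⟨a, b, ha, hb, hab⟩ := hI'
          have hin₂ : HasInput P s₂ :=
            hin₁.of_eq (hi' 0 rfl (by decide)) (hr' 0 rfl) (hr' 1 rfl)
          have h5 : s₂.int 5 0 = k := by rw [hi' 5 rfl (by decide)]; exact hc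
          have v1 := sqDistExpr_val hin₂ (e := intVar 7) (f := intVar 8) ha hb
          have v2 := sqDistExpr_val hin₂ (e := intVar 5) (f := intVar 6) (i := ⟨k, hk⟩)
            (j := ⟨l, hl⟩) h5 hc'
          by_cases hlt : dist (P a) (P b) ^ 2 < dist (P ⟨k, hk⟩) (P ⟨l, hl⟩) ^ 2
          · refine ⟨_, (Runs.condTrue (by simpa only [Test.Holds, v1, v2] using hlt)
              ((Runs.setInt _ _ _ _).seq (Runs.setInt _ _ _ _))).mono (by decide),
              ⟨k, hk⟩, ⟨l, hl⟩, ?_, ?_, fun u v huv => ?_⟩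
            · simp [Store.setInt, IntExpr.val, h5]
            · simp [Store.setInt, IntExpr.val, hc']
            · have hlt' := lt_of_pow_lt_pow_left₀ 2 dist_nonneg hlt
              by_cases hu : (u : ℕ) = k ∧ (v : ℕ) = l
              · obtain rfl : u = ⟨k, hk⟩ := Fin.ext hu.1
                obtain rfl : v = ⟨l, hl⟩ := Fin.ext hu.2
                exact le_rfl
              · exact (hab u v (by omega)).trans hlt'.le
          · refine ⟨_, (Runs.condFalse (by simpa only [Test.Holds, v1, v2] using hlt)
              (Runs.skip _)).mono (by decide), a, b, ?_, ?_, fun u v huv => ?_⟩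
            · simpa [Store.setInt] using ha
            · simpa [Store.setInt] using hb
            · by_cases hu : (u : ℕ) = k ∧ (v : ℕ) = l
              · obtain rfl : u = ⟨k, hk⟩ := Fin.ext hu.1
                obtain rfl : v = ⟨l, hl⟩ := Fin.ext hu.2
                exact le_of_sq_le_sq (not_lt.1 hlt) dist_nonneg
              · exact hab u v (by omega))
      obtain ⟨a, b, ha, hb, hab⟩ := e₂
      refine ⟨s₂, h₂, a, b, by simpa [Store.setInt] using ha, by simpa [Store.setInt] using hb,
        fun u v huv => hab u v ?_⟩
      have := v.2
      omega)
  obtain ⟨a, b, ha, hb, hab⟩ := hI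
  refine ⟨s', (h₀.seq hs').mono ?_, a, b, ha, hb, fun u v => hab u v u.2⟩
  simp only [IntExpr.cost]
  ring_nf
  omega

end RealRAM

/-! ### The fan program and the complete algorithm -/

namespace RealRAM

variable {n : ℕ}

/-- A coordinate difference of the points with the indices `i` and `j`. -/
def diffExpr (A : ℕ) (i j : IntExpr) : RealExpr := .sub (.get A i) (.get A j)

/-- Compute the coordinates along the direction between the points with the indices in the integer
variables `7` and `8`, and the slopes with respect to this direction. -/
def coordinatesProg : Prog :=
  forLoop 5 (.seq
    (.setReal 4 (intVar 5) (.add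
      (.mul (diffExpr 0 (intVar 8) (intVar 7)) (diffExpr 0 (intVar 5) (intVar 7)))
      (.mul (diffExpr 1 (intVar 8) (intVar 7)) (diffExpr 1 (intVar 5) (intVar 7)))))
    (.setReal 5 (intVar 5) (.div (.sub
      (.mul (diffExpr 0 (intVar 8) (intVar 7)) (diffExpr 1 (intVar 5) (intVar 7)))
      (.mul (diffExpr 1 (intVar 8) (intVar 7)) (diffExpr 0 (intVar 5) (intVar 7))))
      (.get 4 (intVar 5)))))

/-- The real arrays `4` and `5` contain the coordinates along the direction from `P a` to `P b`, and
the slopes with respect to this direction. -/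
def HasCoordinates (P : Fin n → Plane) (a b : Fin n) (s : Store) : Prop :=
  ∀ i : Fin n, s.real 4 i = along (P a) (P b) (P i) ∧
    s.real 5 i = across (P a) (P b) (P i) / along (P a) (P b) (P i)

theorem HasCoordinates.of_eq {P : Fin n → Plane} {a b : Fin n} {s s' : Store}
    (h : HasCoordinates P a b s) (h4 : s'.real 4 = s.real 4) (h5 : s'.real 5 = s.real 5) :
    HasCoordinates P a b s' := by
  unfold HasCoordinates
  rw [h4, h5]
  exact h

/-- At `a` the divisor is 0 and the stored slope is the default value 0. `IsFanMap` contains the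
same quotient and asks for no target at `a`, so this is harmless. -/
theorem coordinatesProg_spec {P : Fin n → Plane} {s : Store} (h : HasInput P s) {a b : Fin n}
    (ha : s.int 7 0 = a) (hb : s.int 8 0 = b) :
    ∃ s', Runs coordinatesProg s (120 * n + 9) s' ∧ HasCoordinates P a b s' := by
  obtain ⟨s', hs', hI⟩ := forLoop_spec (C := 5) (n := n) (B := 108) (s₀ := s)
    (p := .seq
    (.setReal 4 (intVar 5) (.add
      (.mul (diffExpr 0 (intVar 8) (intVar 7)) (diffExpr 0 (intVar 5) (intVar 7)))
      (.mul (diffExpr 1 (intVar 8) (intVar 7)) (diffExpr 1 (intVar 5) (intVar 7)))))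
    (.setReal 5 (intVar 5) (.div (.sub
      (.mul (diffExpr 0 (intVar 8) (intVar 7)) (diffExpr 1 (intVar 5) (intVar 7)))
      (.mul (diffExpr 1 (intVar 8) (intVar 7)) (diffExpr 0 (intVar 5) (intVar 7))))
      (.get 4 (intVar 5)))))
    (fun k s => ∀ i : Fin n, (i : ℕ) < k → s.real 4 i = along (P a) (P b) (P i) ∧
      s.real 5 i = across (P a) (P b) (P i) / along (P a) (P b) (P i))
    (by decide) rfl rfl h.1 (fun i hi => absurd hi (Nat.not_lt_zero _))
    (by
      intro k hk s₁ hi hr hc hI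
      have h7 : s₁.int 7 0 = a := by rw [hi 7 rfl (by decide)]; exact ha
      have h8 : s₁.int 8 0 = b := by rw [hi 8 rfl (by decide)]; exact hb
      have hin₁ : HasInput P s₁ := h.of_eq (hi 0 rfl (by decide)) (hr 0 rfl) (hr 1 rfl)
      have hk' := hin₁.2 ⟨k, hk⟩
      have ha' := hin₁.2 a
      have hb' := hin₁.2 b
      refine ⟨_, ((Runs.setReal _ _ _ _).seq (Runs.setReal _ _ _ _)).mono (by decide), ?_⟩
      intro i hik
      by_cases hc' : (i : ℕ) = k
      · obtain rfl : i = ⟨k, hk⟩ := Fin.ext hc'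
        simp only at hk'
        simp [RealExpr.val, diffExpr, Store.setInt, Store.setReal, hc, h7, h8,
          hk'.1, hk'.2, ha'.1, ha'.2, hb'.1, hb'.2, along, across]
      · simpa [Store.setInt, Store.setReal, hc, hc'] using hI i (by omega))
  exact ⟨s', hs', fun i => hI i i.2⟩

/-- The point with the index in the integer variable `C` is far from the one with the index in the
integer variable `7`. -/
def farTest (C : ℕ) : Test :=
  .neg (.realLt (.get 4 (intVar C)) (.div (.get 4 (intVar 8)) (.const 2)))

/-- Find the far point of the greatest slope. -/
def topProg : Prog :=
  .seq (.setInt 11 (.const 0) (intVar 8))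
    (forLoop 5 (.cond (.conj (farTest 5)
      (.realLt (.get 5 (intVar 11)) (.get 5 (intVar 5))))
      (.setInt 11 (.const 0) (intVar 5)) .skip))

/-- The point with the index `i` is far, according to the coordinates in the real array `4`. -/
def IsFar (x : ℕ → ℝ) (b i : ℕ) : Prop := ¬ x i < x b / 2

theorem farTest_holds {s : Store} {C b i : ℕ} (hb : s.int 8 0 = b) (hC : s.int C 0 = i) :
    (farTest C).Holds s ↔ IsFar (s.real 4) b i := by
  simp [farTest, Test.Holds, RealExpr.val, IsFar, hb, hC]

/-- The search starts from `b`, which is far from `a`, so a far candidate exists from the outset. -/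
theorem topProg_spec {s : Store} {b : Fin n} (hn : s.int 0 0 = n) (hb : s.int 8 0 = b)
    (hfar : IsFar (s.real 4) b b) :
    ∃ s', Runs topProg s (50 * n + 20) s' ∧ ∃ t : Fin n, s'.int 11 0 = t ∧
      IsFar (s.real 4) b t ∧ ∀ v : Fin n, IsFar (s.real 4) b v → s.real 5 v ≤ s.real 5 t := by
  have h₀ := Runs.setInt s 11 (.const 0) (intVar 8)
  obtain ⟨s', hs', hI⟩ := forLoop_spec (C := 5) (n := n) (B := 38)
    (s₀ := s.setInt 11 0 (s.int 8 0))
    (p := .cond (.conj (farTest 5) (.realLt (.get 5 (intVar 11)) (.get 5 (intVar 5))))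
      (.setInt 11 (.const 0) (intVar 5)) .skip)
    (fun k s₁ => ∃ t : Fin n, s₁.int 11 0 = t ∧ IsFar (s.real 4) b t ∧
      ∀ v : Fin n, (v : ℕ) < k → IsFar (s.real 4) b v → s.real 5 v ≤ s.real 5 t)
    (by decide) rfl rfl hn
    ⟨b, by simpa [Store.setInt] using hb, hfar, fun v hv => absurd hv (Nat.not_lt_zero _)⟩
    (by
      intro k hk s₁ hi hr hc hI
      obtain ⟨t, ht, hft, hmax⟩ := hI
      have h4 : s₁.real 4 = s.real 4 := hr 4 rfl
      have h5 : s₁.real 5 = s.real 5 := hr 5 rfl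
      have h8 : s₁.int 8 0 = b := by rw [hi 8 rfl (by decide)]; exact hb
      have hiff : (Test.conj (farTest 5)
          (.realLt (.get 5 (intVar 11)) (.get 5 (intVar 5)))).Holds s₁ ↔
          (IsFar (s.real 4) b k ∧ s.real 5 t < s.real 5 k) := by
        rw [← h4, ← farTest_holds h8 hc, ← h5]
        simp [Test.Holds, RealExpr.val, ht, hc]
      by_cases hk' : IsFar (s.real 4) b k ∧ s.real 5 t < s.real 5 k
      · refine ⟨_, (Runs.condTrue (hiff.2 hk') (Runs.setInt _ _ _ _)).mono (by decide), ⟨k, hk⟩,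
          by simp [Store.setInt, IntExpr.val, hc], hk'.1, fun v hv hf => ?_⟩
        rcases Nat.lt_succ_iff_lt_or_eq.1 hv with h | h
        · exact (hmax v h hf).trans hk'.2.le
        · rw [h]
      · refine ⟨_, (Runs.condFalse (mt hiff.1 hk') (Runs.skip _)).mono (by decide), t,
          by simpa [Store.setInt] using ht, hft, fun v hv hf => ?_⟩
        rcases Nat.lt_succ_iff_lt_or_eq.1 hv with h | h
        · exact hmax v h hf
        · rw [h] at hf ⊢
          by_contra hlt
          exact hk' ⟨hf, not_le.1 hlt⟩)
  obtain ⟨t, ht, hft, hmax⟩ := hI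
  refine ⟨s', (h₀.seq hs').mono ?_, t, ht, hft, fun v => hmax v v.2⟩
  simp only [IntExpr.cost, intVar_cost]
  omega

/-- Search the parent of a near point, whose index is in the integer variable `5`. -/
def targetProg : Prog :=
  .seq (.setInt 12 (.const 0) (intVar 11))
    (forLoop 6 (.cond (.conj (farTest 6)
      (.conj (.neg (.realLt (.get 5 (intVar 6)) (.get 5 (intVar 5))))
        (.realLt (.get 5 (intVar 6)) (.get 5 (intVar 12)))))
      (.setInt 12 (.const 0) (intVar 6)) .skip))

theorem targetProg_spec {s : Store} {b t i : ℕ} (hn : s.int 0 0 = n) (hb : s.int 8 0 = b)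
    (ht : s.int 11 0 = t) (hv : s.int 5 0 = i) :
    ∃ s', Runs targetProg s (70 * n + 20) s' ∧
      IsFanTarget (IsFar (s.real 4) b) (s.real 5) t (s.real 5 i) n (s'.int 12 0) := by
  have h₀ := Runs.setInt s 12 (.const 0) (intVar 11)
  obtain ⟨s', hs', hI⟩ := forLoop_spec (C := 6) (n := n) (B := 58)
    (s₀ := s.setInt 12 0 (s.int 11 0))
    (p := .cond (.conj (farTest 6)
      (.conj (.neg (.realLt (.get 5 (intVar 6)) (.get 5 (intVar 5))))
        (.realLt (.get 5 (intVar 6)) (.get 5 (intVar 12)))))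
      (.setInt 12 (.const 0) (intVar 6)) .skip)
    (fun k s₁ => IsFanTarget (IsFar (s.real 4) b) (s.real 5) t (s.real 5 i) k (s₁.int 12 0))
    (by decide) rfl rfl hn
    (by simpa [Store.setInt, ht] using isFanTarget_zero _ _ _ _)
    (by
      intro k hk s₁ hi hr hc hI
      have h4 : s₁.real 4 = s.real 4 := hr 4 rfl
      have h5 : s₁.real 5 = s.real 5 := hr 5 rfl
      have h8 : s₁.int 8 0 = b := by rw [hi 8 rfl (by decide)]; exact hb
      have hi5 : s₁.int 5 0 = i := by rw [hi 5 rfl (by decide)]; exact hv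
      have hiff : (Test.conj (farTest 6)
          (.conj (.neg (.realLt (.get 5 (intVar 6)) (.get 5 (intVar 5))))
            (.realLt (.get 5 (intVar 6)) (.get 5 (intVar 12))))).Holds s₁ ↔
          (IsFar (s.real 4) b k ∧ ¬ s.real 5 k < s.real 5 i ∧
            s.real 5 k < s.real 5 (s₁.int 12 0)) := by
        rw [← h4, ← farTest_holds h8 hc, ← h5]
        simp [Test.Holds, RealExpr.val, hc, hi5]
      by_cases hk' : IsFar (s.real 4) b k ∧ ¬ s.real 5 k < s.real 5 i ∧
          s.real 5 k < s.real 5 (s₁.int 12 0)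
      · refine ⟨_, (Runs.condTrue (hiff.2 hk') (Runs.setInt _ _ _ _)).mono (by decide), ?_⟩
        simpa [Store.setInt, IntExpr.val, hc] using hI.step hk'
      · refine ⟨_, (Runs.condFalse (mt hiff.1 hk') (Runs.skip _)).mono (by decide), ?_⟩
        simpa [Store.setInt] using hI.stay hk')
  refine ⟨s', (h₀.seq hs').mono ?_, hI⟩
  simp only [IntExpr.cost, intVar_cost]
  omega

/-- Compute the parent map of the fan. -/
def parentsProg : Prog :=
  .seq (forLoop 5 (.seq targetProg
    (.cond (farTest 5) (.setInt 3 (intVar 5) (intVar 7)) (.setInt 3 (intVar 5) (intVar 12)))))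
    (.seq (.setInt 3 (intVar 7) (intVar 7)) (.setInt 9 (.const 0) (intVar 7)))

/-- The loop treats `a` like any other point; the entry written for it is meaningless and is
replaced by the root entry afterwards. -/
theorem parentsProg_spec {s : Store} {a b t : Fin n} (hn : s.int 0 0 = n) (ha : s.int 7 0 = a)
    (hb : s.int 8 0 = b) (ht : s.int 11 0 = t) :
    ∃ s', Runs parentsProg s ((70 * n + 80) * n + 30) s' ∧ s'.int 9 0 = a ∧
      ∃ f : Fin n → Fin n, (∀ i : Fin n, s'.int 3 i = f i) ∧ f a = a ∧
      (∀ i : Fin n, IsFar (s.real 4) b i → f i = a) ∧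
      ∀ i, i ≠ a → ¬ IsFar (s.real 4) b i →
        IsFanTarget (IsFar (s.real 4) b) (s.real 5) t (s.real 5 i) n (f i) := by
  obtain ⟨s', hs', hI⟩ := forLoop_spec (C := 5) (n := n) (B := 70 * n + 60) (s₀ := s)
    (p := .seq targetProg
      (.cond (farTest 5) (.setInt 3 (intVar 5) (intVar 7)) (.setInt 3 (intVar 5) (intVar 12))))
    (fun k s₁ => ∀ i : Fin n, (i : ℕ) < k →
      (IsFar (s.real 4) b i → s₁.int 3 i = a) ∧
      (¬ IsFar (s.real 4) b i →
        IsFanTarget (IsFar (s.real 4) b) (s.real 5) t (s.real 5 i) n (s₁.int 3 i)))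
    (by decide) rfl rfl hn (fun i hi => absurd hi (Nat.not_lt_zero _))
    (by
      intro k hk s₁ hi hr hc hI
      have h4 : s₁.real 4 = s.real 4 := hr 4 rfl
      have h5 : s₁.real 5 = s.real 5 := hr 5 rfl
      have h0 : s₁.int 0 0 = n := by rw [hi 0 rfl (by decide)]; exact hn
      have h7 : s₁.int 7 0 = a := by rw [hi 7 rfl (by decide)]; exact ha
      have h8 : s₁.int 8 0 = b := by rw [hi 8 rfl (by decide)]; exact hb
      have h11 : s₁.int 11 0 = t := by rw [hi 11 rfl (by decide)]; exact ht
      obtain ⟨s₂, h₂, e₂⟩ := targetProg_spec h0 h8 h11 hc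
      rw [h4, h5] at e₂
      have g4 : s₂.real 4 = s.real 4 := by rw [h₂.real_frame rfl, h4]
      have g7 : s₂.int 7 0 = a := by rw [h₂.int_frame rfl, h7]
      have g8 : s₂.int 8 0 = b := by rw [h₂.int_frame rfl, h8]
      have g5 : s₂.int 5 0 = k := by rw [h₂.int_frame rfl, hc]
      have g3 : s₂.int 3 = s₁.int 3 := h₂.int_frame rfl
      have hiff : (farTest 5).Holds s₂ ↔ IsFar (s.real 4) b k := by
        rw [farTest_holds g8 g5, g4]
      by_cases hf : IsFar (s.real 4) b k
      · refine ⟨_, (h₂.seq (Runs.condTrue (hiff.2 hf) (Runs.setInt _ _ _ _))).mono ?_, ?_⟩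
        · simp only [Test.cost, farTest, RealExpr.cost, intVar_cost]; omega
        intro i hik
        by_cases h : (i : ℕ) = k
        · simp only [h]
          simp [Store.setInt, g5, g7, hf]
        · simpa [Store.setInt, g5, g7, h, g3] using hI i (by omega)
      · refine ⟨_, (h₂.seq (Runs.condFalse (mt hiff.1 hf) (Runs.setInt _ _ _ _))).mono ?_, ?_⟩
        · simp only [Test.cost, farTest, RealExpr.cost, intVar_cost]; omega
        intro i hik
        by_cases h : (i : ℕ) = k
        · simp only [h]
          simpa [Store.setInt, g5, hf] using e₂
        · simpa [Store.setInt, g5, h, g3] using hI i (by omega))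
  have e7 : s'.int 7 0 = a := by rw [hs'.int_frame rfl, ha]
  refine ⟨_, (hs'.seq ((Runs.setInt _ _ _ _).seq (Runs.setInt _ _ _ _))).mono ?_, ?_, ?_⟩
  · simp only [IntExpr.cost, intVar_cost]; ring_nf; omega
  · simp [Store.setInt, IntExpr.val, e7]
  -- All stored parents are valid indices, so the array defines a map on `Fin n`.
  · have hlt : ∀ i : Fin n, s'.int 3 i < n := by
      intro i
      by_cases hf : IsFar (s.real 4) b i
      · rw [(hI i i.2).1 hf]; exact a.2
      · exact ((hI i i.2).2 hf).lt_of t.2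
    refine ⟨fun i => if i = a then a else ⟨s'.int 3 i, hlt i⟩, fun i => ?_, by simp, fun i hf => ?_,
      fun i hia hf => ?_⟩
    · by_cases hia : i = a
      · simp [Store.setInt, IntExpr.val, e7, hia]
      · have hne : (i : ℕ) ≠ a := fun e => hia (Fin.ext e)
        simp [Store.setInt, IntExpr.val, e7, hia, hne]
    · by_cases hia : i = a
      · simp [hia]
      · simp only [hia, if_false]
        exact Fin.ext ((hI i i.2).1 hf)
    · simp only [hia, if_false]
      exact (hI i i.2).2 hf

/-- Construct the fan at the points with the indices in the integer variables `7` and `8`. -/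
def fanProg : Prog := .seq coordinatesProg (.seq topProg parentsProg)

theorem fanProg_spec {P : Fin n → Plane} {s : Store} (h : HasInput P s) {a b : Fin n}
    (ha : s.int 7 0 = a) (hb : s.int 8 0 = b) :
    ∃ s', Runs fanProg s ((70 * n + 250) * n + 59) s' ∧ s'.int 9 0 = a ∧
      ∃ f : Fin n → Fin n, (∀ i : Fin n, s'.int 3 i = f i) ∧ IsFanMap P a b f := by
  obtain ⟨s₁, h₁, e₁⟩ := coordinatesProg_spec h ha hb
  have hfar : ∀ i : Fin n, IsFar (s₁.real 4) b i ↔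
      ¬ along (P a) (P b) (P i) < along (P a) (P b) (P b) / 2 := by
    intro i
    rw [IsFar, (e₁ i).1, (e₁ b).1]
  obtain ⟨s₂, h₂, t, ht, hft, hmax⟩ := topProg_spec (s := s₁) (b := b)
    (by rw [h₁.int_frame rfl]; exact h.1) (by rw [h₁.int_frame rfl]; exact hb)
    (by
      rw [hfar, along_self]
      have := sq_nonneg (dist (P a) (P b))
      push Not
      linarith)
  obtain ⟨s₃, h₃, h9, f, hf, hfa, hf1, hf2⟩ := parentsProg_spec (s := s₂) (a := a) (b := b) (t := t)
    (by rw [h₂.int_frame rfl, h₁.int_frame rfl]; exact h.1)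
    (by rw [h₂.int_frame rfl, h₁.int_frame rfl]; exact ha)
    (by rw [h₂.int_frame rfl, h₁.int_frame rfl]; exact hb) ht
  have r4 : s₂.real 4 = s₁.real 4 := h₂.real_frame rfl
  have r5 : s₂.real 5 = s₁.real 5 := h₂.real_frame rfl
  rw [r4] at hf1 hf2
  rw [r5] at hf2
  refine ⟨s₃, (h₁.seq (h₂.seq h₃)).mono (by ring_nf; omega), h9, f, hf, hfa,
    fun v hv => hf1 v ((hfar v).2 hv),
    s₁.real 5, IsFar (s₁.real 4) b, t, fun v => (e₁ v).2, hfar, hft, hmax, hf2⟩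

/-- Interchange the integer variables `7` and `8`. -/
def swapProg : Prog :=
  .seq (.setInt 12 (.const 0) (intVar 7))
    (.seq (.setInt 7 (.const 0) (intVar 8)) (.setInt 8 (.const 0) (intVar 12)))

theorem swapProg_spec (s : Store) :
    ∃ s', Runs swapProg s 12 s' ∧ s'.int 7 0 = s.int 8 0 ∧ s'.int 8 0 = s.int 7 0 := by
  refine ⟨_, ((Runs.setInt _ _ _ _).seq ((Runs.setInt _ _ _ _).seq
    (Runs.setInt _ _ _ _))).mono (by decide), ?_, ?_⟩ <;> simp [Store.setInt, IntExpr.val]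

/-- Output the longest one among all stars and the two fans at a diametral pair. -/
def longTreeProg : Prog :=
  .seq (.setReal 2 (.const 0) (.const (-1))) (.seq starsProg (.seq diameterProg
    (.seq (.seq fanProg improveProg) (.seq swapProg (.seq fanProg improveProg)))))

/-- If `a = b`, the diameter is zero and injectivity leaves a single point, where nothing is to be
checked. -/
theorem isPlaneParentMap_of_isFanMap {P : Fin n → Plane} (hP : Function.Injective P) {a b : Fin n}
    (hd : ∀ u v, dist (P u) (P v) ≤ dist (P a) (P b)) {f : Fin n → Fin n}
    (hf : IsFanMap P a b f) : IsPlaneParentMap P f a := by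
  by_cases hab : a = b
  · have hsub : ∀ v, v = a := by
      intro v
      have := hd v a
      rw [← hab, dist_self] at this
      exact hP (dist_le_zero.1 this)
    exact ⟨hf.root, ⟨fun _ => 0, fun v hv => absurd (hsub v) hv⟩,
      fun v w hv => absurd (hsub v) hv⟩
  · exact hf.isPlaneParentMap hP hab fun v => hd v b

theorem fan_improve_spec {P : Fin n → Plane} (hP : Function.Injective P) {s : Store}
    (h : HasInput P s) (ht : HasTree P s) {a b : Fin n}
    (hd : ∀ u v, dist (P u) (P v) ≤ dist (P a) (P b)) (ha : s.int 7 0 = a) (hb : s.int 8 0 = b) :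
    ∃ s', Runs (.seq fanProg improveProg) s ((70 * n + 390) * n + 139) s' ∧ HasTree P s' ∧
      s.real 2 0 ≤ s'.real 2 0 ∧
      ∃ f, IsFanMap P a b f ∧ parentLength P f ≤ s'.real 2 0 := by
  obtain ⟨s₁, h₁, h9, f, hf, hfan⟩ := fanProg_spec h ha hb
  obtain ⟨s₂, h₂, t₂, l₂, m₂⟩ := improveProg_spec
    (h.of_eq (h₁.int_frame rfl) (h₁.real_frame rfl) (h₁.real_frame rfl))
    (ht.of_eq (h₁.int_frame rfl) (h₁.int_frame rfl) (h₁.real_frame rfl))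
    (isPlaneParentMap_of_isFanMap hP hd hfan) hf h9
  rw [h₁.real_frame rfl] at l₂
  exact ⟨s₂, (h₁.seq h₂).mono (by ring_nf; omega), t₂, l₂, f, hfan, m₂⟩

theorem longTreeProg_spec (hn : 0 < n) {P : Fin n → Plane} (hP : Function.Injective P) :
    ∃ s', Runs longTreeProg (inputStore P) (1000 * (n + 1) ^ 2) s' ∧
      IsNoncrossingSpanningTree P (outputGraph n s') ∧
      ∀ T : SimpleGraph (Fin n), IsNoncrossingSpanningTree P T →
        (0.519 : ℝ) * totalLength P T ≤ totalLength P (outputGraph n s') := by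
  have h₀ := Runs.setReal (inputStore P) 2 (.const 0) (.const (-1))
  have hin₀ : HasInput P ((inputStore P).setReal 2 0 (-1)) := hasInput_inputStore P
  obtain ⟨s₁, h₁, t₁, m₁⟩ := starsProg_spec hin₀ (Or.inl (by simp [Store.setReal_real_self]))
  have hin₁ := hin₀.of_eq (h₁.int_frame rfl) (h₁.real_frame rfl) (h₁.real_frame rfl)
  obtain ⟨s₂, h₂, a, b, ha, hb, hd⟩ := diameterProg_spec hn hin₁
  have hin₂ := hin₁.of_eq (h₂.int_frame rfl) (h₂.real_frame rfl) (h₂.real_frame rfl)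
  have t₂ := t₁.of_eq (h₂.int_frame rfl) (h₂.int_frame rfl) (h₂.real_frame rfl)
  have b₂ : s₂.real 2 = s₁.real 2 := h₂.real_frame rfl
  obtain ⟨s₃, h₃, t₃, l₃, f, hf, m₃⟩ := fan_improve_spec hP hin₂ t₂ hd ha hb
  have hin₃ := hin₂.of_eq (h₃.int_frame rfl) (h₃.real_frame rfl) (h₃.real_frame rfl)
  obtain ⟨s₄, h₄, e7, e8⟩ := swapProg_spec s₃
  have hin₄ := hin₃.of_eq (h₄.int_frame rfl) (h₄.real_frame rfl) (h₄.real_frame rfl)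
  have t₄ := t₃.of_eq (h₄.int_frame rfl) (h₄.int_frame rfl) (h₄.real_frame rfl)
  have b₄ : s₄.real 2 = s₃.real 2 := h₄.real_frame rfl
  obtain ⟨s₅, h₅, t₅, l₅, f', hf', m₅⟩ := fan_improve_spec hP hin₄ t₄ (a := b) (b := a)
    (by intro u v; rw [dist_comm (P b)]; exact hd u v)
    (by rw [e7, h₃.int_frame rfl, hb]) (by rw [e8, h₃.int_frame rfl, ha])
  rw [b₂] at l₃
  rw [b₄] at l₅
  -- The record length never decreases, so the bounds from earlier stages survive to the end.
  have hstar : ∀ c, parentLength P (fun _ => c) ≤ s₅.real 2 0 := fun c =>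
    (m₁ c).trans (l₃.trans l₅)
  have hpos : ∀ g : Fin n → Fin n, 0 ≤ parentLength P g := fun g =>
    Finset.sum_nonneg fun _ _ => dist_nonneg
  refine ⟨s₅, (Runs.seq (by simpa [IntExpr.val, RealExpr.val] using h₀) (h₁.seq (h₂.seq
    (h₃.seq (h₄.seq h₅))))).mono ?_, ?_⟩
  · simp only [IntExpr.cost, RealExpr.cost]
    ring_nf
    omega
  -- The initial record `-1` has been replaced, since every star has nonnegative length.
  obtain hneg | ⟨g, r, hg, hlen, hout⟩ := t₅
  · exact absurd ((hpos _).trans (hstar a)) (not_le.2 hneg)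
  rw [hout, hg.totalLength_eq, ← hlen]
  refine ⟨hg.isNoncrossingSpanningTree, fun T hT => ?_⟩
  -- Here the diameter is zero, so every spanning tree has length at most 0.
  by_cases hab : a = b
  · have h0 := totalLength_le_sum_erase hT.1 a (fun _ => dist (P a) (P b)) hd
    rw [hab, dist_self, Finset.sum_const_zero] at h0
    have := (hpos _).trans (hstar a)
    linarith
  · exact approximation_of_stars_and_fans hP hab hd hf hf' hstar (m₃.trans l₅) m₅ hT.1

end RealRAM

theorem theorem2 :
    ∃ (algo : RealRAM.Prog) (timeBound : Polynomial ℕ),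
      ∀ (n : ℕ), 0 < n → ∀ P : Fin n → Plane, Function.Injective P →
        ∃ (t : ℕ) (out : RealRAM.Store),
          RealRAM.Exec algo (RealRAM.inputStore P) t out ∧
          t ≤ timeBound.eval n ∧
          IsNoncrossingSpanningTree P (RealRAM.outputGraph n out) ∧
          ∀ T : SimpleGraph (Fin n), IsNoncrossingSpanningTree P T →
            (0.519 : ℝ) * totalLength P T ≤ totalLength P (RealRAM.outputGraph n out) := by
  refine ⟨RealRAM.longTreeProg, Polynomial.C 1000 * (Polynomial.X + 1) ^ 2, fun n hn P hP => ?_⟩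
  obtain ⟨out, ⟨t, hex, ht⟩, hout⟩ := RealRAM.longTreeProg_spec hn hP
  exact ⟨t, out, hex, by simpa using ht, hout⟩
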